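/- Let $k$ be a field. For a finite-dimensional Hopf algebra $A$ over $k$ let $\operatorname{Rep} A$ be the monoidal category of finite-dimensional right $A$-modules, with action written $w\leftharpoonup a$. Let $k\to K\xrightarrow{i}H\xrightarrow{\pi}\overline H\to k$ be an exact sequence of finite-dimensional Hopf algebras, that is, $i$ is injective, $\pi$ is surjective, $\ker\pi=H\,i(K)^+$ and $i(K)=\{h\in H:(\mathrm{id}\otimes\pi)\Delta(h)=h\otimes 1\}$. Let it be cleft with data $(\,.\,,\sigma,\rho,\tau)$: a weak action $\overline H\otimes K\to K$ (so $1.a=a$, $x.1=\varepsilon(x)1$, $x.(ab)=(x_{(1)}.a)(x_{(2)}.b)$), a weak coaction $\rho:\overline H\to\overline H\otimes K$, $\rho(x)=x_{(0)}\otimes x_{(1)}$ (so $x_{(0)}\varepsilon(x_{(1)})=x$, $\varepsilon(x_{(0)})x_{(1)}=\varepsilon(x)1$, and $(\Delta\otimes \mathrm{id})\rho(x)=(x_{(1)})_{(0)}\otimes(x_{(2)})_{(0)}\otimes(x_{(1)})_{(1)}(x_{(2)})_{(1)}$), and linear maps $\sigma:\overline H\otimes\overline H\to K$, $\tau:\overline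 H\to K\otimes K$ with $\sigma(1,x)=\sigma(x,1)=\varepsilon(x)1$ and $(\varepsilon\otimes\mathrm{id})\tau(x)=(\mathrm{id}\otimes\varepsilon)\tau(x)=\varepsilon(x)1$, such that $H$ is identified with $K\otimes\overline H$ (elements $a\#x$) with $$(a\#x)(b\#y)=a(x_{(1)}.b)\sigma(x_{(2)},y_{(1)})\#x_{(3)}y_{(2)},\qquad \Delta(a\#x)=\Delta(a)\,\tau(x_{(1)})\,\bigl(1\#(x_{(2)})_{(0)}\otimes(x_{(2)})_{(1)}\#x_{(3)}\bigr),$$ unit $1\#1$, counit $\varepsilon\otimes\varepsilon$, $i(a)=a\#1$ and $\pi(a\#x)=\varepsilon(a)x$. For $W\in\operatorname{Rep}K$ put $T(W)=W\otimes\overline H$ with $(w\otimes x)\leftharpoonup a=w\leftharpoonup(x_{(1)}.a)\otimes x_{(2)}$. Then the maps $$\mu_W(w\otimes x\otimes y)=w\leftharpoonup\sigma(x_{(1)},y_{(1)})\otimes x_{(2)}y_{(2)},\qquad \eta_W(w)=w\otimes 1,$$ $$\xi_{W,U}(w\otimes u\otimes x)=\bigl(w\leftharpoonup s\otimes (x_{(2)})_{(0)}\bigr)\otimes\bigl(u\leftharpoonup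 t\,(x_{(2)})_{(1)}\otimes x_{(3)}\bigr)\quad\text{where } s\otimes t=\tau(x_{(1)})\text{ (summation understood)},\qquad \phi=\mathrm{id}\otimes\varepsilon:k\otimes\overline H\to k$$ are the multiplication, unit and comonoidal structure of a Hopf monad structure on $T:\operatorname{Rep}K\to\operatorname{Rep}K$ (a bimonad whose left and right fusion operators are invertible). This Hopf monad is normal ($T$ is $k$-linear and right exact, and $T(\mathbf 1)$ is a finite direct sum of copies of $\mathbf 1$) and $T$ is faithful. It is the Hopf monad associated to the exact sequence $\operatorname{Rep}\overline H\to\operatorname{Rep}H\to\operatorname{Rep}K$: the restriction functor $F=i^*:\operatorname{Rep}H\to\operatorname{Rep}K$ has a left adjoint, and for every left adjoint $L$ of $F$ there is an isomorphism $\theta:T\to FL$ that respects multiplications, units and comonoidal structures, where $FL$ carries the bimonad structure of the adjunction with the strict monoidal functor $F$, and $\theta$ is given by $\theta_W(w\leftharpoonup a\otimes x)=u_W(w)\leftharpoonup(a\#x)$, with $u$ the unit of the adjunction. -/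

import Mathlib

open CategoryTheory MonoidalCategory TensorProduct Coalgebra

universe v u

/-! ### Bimonads and Hopf monads on a monoidal category -/

section HopfMonads

variable {C : Type u} [Category.{v} C] [MonoidalCategory C]

open Functor.OplaxMonoidal

/-- A bimonad structure on an endofunctor `T` of a monoidal category: a monad structure `(μ, η)`
together with a comonoidal structure on `T` (with components `δ = ξ : T (X ⊗ Y) ⟶ T X ⊗ T Y` and
`Functor.OplaxMonoidal.η = φ : T 𝟙_ ⟶ 𝟙_`) such that `μ` and `η` are comonoidal
transformations. -/
structure BimonadStructure (T : C ⥤ C) where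
  /-- the multiplication of the monad -/
  mu : T ⋙ T ⟶ T
  /-- the unit of the monad -/
  unit : 𝟭 C ⟶ T
  /-- the comonoidal structure -/
  comonoidal : T.OplaxMonoidal
  assoc : ∀ X, T.map (mu.app X) ≫ mu.app X = mu.app (T.obj X) ≫ mu.app X
  left_unit : ∀ X, unit.app (T.obj X) ≫ mu.app X = 𝟙 (T.obj X)
  right_unit : ∀ X, T.map (unit.app X) ≫ mu.app X = 𝟙 (T.obj X)
  mu_xi : ∀ X Y, mu.app (X ⊗ Y) ≫ δ T X Y =
    T.map (δ T X Y) ≫ δ T (T.obj X) (T.obj Y) ≫ (mu.app X ⊗ₘ mu.app Y)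
  mu_phi : mu.app (𝟙_ C) ≫ η T = T.map (η T) ≫ η T
  unit_xi : ∀ X Y, unit.app (X ⊗ Y) ≫ δ T X Y = (unit.app X ⊗ₘ unit.app Y)
  unit_phi : unit.app (𝟙_ C) ≫ η T = 𝟙 (𝟙_ C)

namespace BimonadStructure

variable {T T' : C ⥤ C}

/-- The underlying monad of a bimonad. -/
def toMonad (S : BimonadStructure T) : Monad C where
  toFunctor := T
  μ := S.mu
  η := S.unit
  assoc := S.assoc
  left_unit := S.left_unit
  right_unit := S.right_unit

/-- The component `ξ_{X,Y} : T (X ⊗ Y) ⟶ T X ⊗ T Y` of the comonoidal structure. -/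
def xi (S : BimonadStructure T) (X Y : C) : T.obj (X ⊗ Y) ⟶ T.obj X ⊗ T.obj Y :=
  letI := S.comonoidal
  δ T X Y

/-- The counit `φ : T 𝟙_ ⟶ 𝟙_` of the comonoidal structure. -/
def phi (S : BimonadStructure T) : T.obj (𝟙_ C) ⟶ 𝟙_ C :=
  letI := S.comonoidal
  η T

/-- The left fusion operator `H^l_{X,Y} = (id ⊗ μ_Y) ξ_{X,TY}`. -/
def leftFusion (S : BimonadStructure T) (X Y : C) :
    T.obj (X ⊗ T.obj Y) ⟶ T.obj X ⊗ T.obj Y :=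
  S.xi X (T.obj Y) ≫ (T.obj X ◁ S.mu.app Y)

/-- The right fusion operator `H^r_{X,Y} = (μ_X ⊗ id) ξ_{TX,Y}`. -/
def rightFusion (S : BimonadStructure T) (X Y : C) :
    T.obj (T.obj X ⊗ Y) ⟶ T.obj X ⊗ T.obj Y :=
  S.xi (T.obj X) Y ≫ (S.mu.app X ▷ T.obj Y)

/-- A bimonad is a Hopf monad if all its fusion operators are isomorphisms. -/
def IsHopf (S : BimonadStructure T) : Prop :=
  ∀ X Y, IsIso (S.leftFusion X Y) ∧ IsIso (S.rightFusion X Y)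

/-- A natural isomorphism is an isomorphism of bimonads if it respects the multiplications, the
units and the comonoidal structures. -/
structure IsBimonadIso (S : BimonadStructure T) (S' : BimonadStructure T') (θ : T ≅ T') :
    Prop where
  mu : ∀ X, S.mu.app X ≫ θ.hom.app X =
    T.map (θ.hom.app X) ≫ θ.hom.app (T'.obj X) ≫ S'.mu.app X
  unit : ∀ X, S.unit.app X ≫ θ.hom.app X = S'.unit.app X
  xi : ∀ X Y, S.xi X Y ≫ (θ.hom.app X ⊗ₘ θ.hom.app Y) = θ.hom.app (X ⊗ Y) ≫ S'.xi X Y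
  phi : θ.hom.app (𝟙_ C) ≫ S'.phi = S.phi

end BimonadStructure

/-- An object is trivial if it is a finite direct sum of copies of the unit object. -/
def IsTrivialObject [Preadditive C] (X : C) : Prop :=
  ∃ (n : ℕ) (b : Limits.Bicone (fun _ : Fin n => 𝟙_ C)), Nonempty b.IsBilimit ∧ Nonempty (b.pt ≅ X)

variable {D : Type*} [Category D] [MonoidalCategory D]

/-- The bimonad `F ∘ L` on `C` of an adjunction `L ⊣ F` whose right adjoint `F` is a strong monoidal
functor: it is the monad of the adjunction, and its comonoidal structure is composed of the
comonoidal structure of `L` that corresponds to the monoidal structure of `F` under the adjunction,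
and of that of `F`. -/
def CategoryTheory.Adjunction.bimonad {L : C ⥤ D} {F : D ⥤ C} (adj : L ⊣ F) [F.Monoidal] :
    BimonadStructure (L ⋙ F) :=
  letI : L.OplaxMonoidal := adj.leftAdjointOplaxMonoidal
  { mu :=
      { app := fun X => F.map (adj.counit.app (L.obj X))
        naturality := fun X Y f => by
          change F.map (L.map (F.map (L.map f))) ≫ _ = _ ≫ F.map (L.map f)
          rw [← F.map_comp, ← F.map_comp]
          exact congrArg _ (adj.counit.naturality (L.map f)) }
    unit := adj.unit
    comonoidal := inferInstance
    assoc := fun X => adj.toMonad.assoc X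
    left_unit := fun X => adj.toMonad.left_unit X
    right_unit := fun X => adj.toMonad.right_unit X
    mu_xi := fun X Y => by
      have h₁ : adj.counit.app (L.obj (X ⊗ Y)) ≫ δ L X Y =
          L.map (F.map (δ L X Y)) ≫ adj.counit.app (L.obj X ⊗ L.obj Y) :=
        (adj.counit.naturality (δ L X Y)).symm
      have h₂ := adj.map_μ_comp_counit_app_tensor (L.obj X) (L.obj Y)
      have h₃ : L.map (δ F (L.obj X) (L.obj Y)) ≫
          L.map (Functor.LaxMonoidal.μ F (L.obj X) (L.obj Y)) = 𝟙 _ := by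
        rw [← L.map_comp, Functor.Monoidal.δ_μ, L.map_id]
      have h₄ : adj.counit.app (L.obj X ⊗ L.obj Y) = L.map (δ F (L.obj X) (L.obj Y)) ≫
          δ L _ _ ≫ (adj.counit.app (L.obj X) ⊗ₘ adj.counit.app (L.obj Y)) := by
        rw [← h₂, reassoc_of% h₃]
      change F.map (adj.counit.app (L.obj (X ⊗ Y))) ≫ F.map (δ L X Y) ≫ δ F _ _ =
        F.map (L.map (F.map (δ L X Y) ≫ δ F _ _)) ≫ (F.map (δ L _ _) ≫ δ F _ _) ≫
          (F.map (adj.counit.app (L.obj X)) ⊗ₘ F.map (adj.counit.app (L.obj Y)))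
      rw [← F.map_comp_assoc, h₁, h₄]
      simp only [F.map_comp, L.map_comp, Category.assoc]
      rw [δ_natural]
      rfl
    mu_phi := by
      have h₁ : adj.counit.app (L.obj (𝟙_ C)) ≫ η L =
          L.map (F.map (η L)) ≫ adj.counit.app (𝟙_ D) :=
        (adj.counit.naturality (η L)).symm
      have h₂ := adj.map_ε_comp_counit_app_unit
      have h₃ : L.map (η F) ≫ L.map (Functor.LaxMonoidal.ε F) = 𝟙 _ := by
        rw [← L.map_comp, Functor.Monoidal.η_ε, L.map_id]
      have h₄ : adj.counit.app (𝟙_ D) = L.map (η F) ≫ η L := by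
        rw [← h₂, reassoc_of% h₃]
      change F.map (adj.counit.app (L.obj (𝟙_ C))) ≫ F.map (η L) ≫ η F =
        F.map (L.map (F.map (η L) ≫ η F)) ≫ F.map (η L) ≫ η F
      rw [← F.map_comp_assoc, h₁, h₄]
      simp only [F.map_comp, L.map_comp, Category.assoc]
    unit_xi := fun X Y => by
      change adj.unit.app (X ⊗ Y) ≫ F.map (δ L X Y) ≫ δ F _ _ = _
      rw [adj.unit_app_tensor_comp_map_δ_assoc, Functor.Monoidal.μ_δ]
      exact Category.comp_id _
    unit_phi := by
      change adj.unit.app (𝟙_ C) ≫ F.map (η L) ≫ η F = _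
      rw [adj.unit_app_unit_comp_map_η_assoc, Functor.Monoidal.ε_η] }

lemma CategoryTheory.Adjunction.bimonad_toMonad {L : C ⥤ D} {F : D ⥤ C} (adj : L ⊣ F) [F.Monoidal] :
    adj.bimonad.toMonad = adj.toMonad := rfl

end HopfMonads

/-! ### Finite-dimensional right modules -/

/-- A finite-dimensional right module over the `k`-algebra `A`; `act a w` is `w ↼ a`. -/
structure RightRep (k : Type u) [Field k] (A : Type u) [Ring A] [Algebra k A] where
  /-- the underlying vector space -/
  carrier : Type u
  [addCommGroup : AddCommGroup carrier]
  [module : Module k carrier]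
  [finite : FiniteDimensional k carrier]
  /-- the right action -/
  act : A →ₗ[k] Module.End k carrier
  act_one : act 1 = LinearMap.id
  act_mul : ∀ a b, act (a * b) = act b ∘ₗ act a

namespace RightRep

attribute [instance] addCommGroup module finite

section Category

variable {k : Type u} [Field k] {A : Type u} [Ring A] [Algebra k A]

instance : CoeSort (RightRep k A) (Type u) := ⟨carrier⟩

/-- Morphisms of right modules. -/
@[ext]
structure Hom (V W : RightRep k A) where
  /-- the underlying linear map -/
  hom : V →ₗ[k] W
  comm : ∀ a, hom ∘ₗ V.act a = W.act a ∘ₗ hom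

instance : Category (RightRep k A) where
  Hom := Hom
  id V := ⟨LinearMap.id, fun _ => rfl⟩
  comp f g := ⟨g.hom ∘ₗ f.hom, fun a => by
    rw [LinearMap.comp_assoc, f.comm, ← LinearMap.comp_assoc, g.comm, LinearMap.comp_assoc]⟩

@[ext]
lemma hom_ext {V W : RightRep k A} {f g : V ⟶ W} (h : f.hom = g.hom) : f = g := Hom.ext h

@[simp] lemma id_hom (V : RightRep k A) : Hom.hom (𝟙 V) = LinearMap.id := rfl

@[simp] lemma comp_hom {V W X : RightRep k A} (f : V ⟶ W) (g : W ⟶ X) :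
    (f ≫ g).hom = g.hom ∘ₗ f.hom := rfl

/-- The underlying linear map of a morphism determines it, and vice versa. -/
def homEquiv (V W : RightRep k A) :
    (V ⟶ W) ≃ {f : V →ₗ[k] W // ∀ a, f ∘ₗ V.act a = W.act a ∘ₗ f} where
  toFun f := ⟨f.hom, f.comm⟩
  invFun f := ⟨f.1, f.2⟩

variable (k A) in
/-- The equivariant maps, as a subspace of all linear maps. -/
def equivariant (V W : RightRep k A) : Submodule k (V →ₗ[k] W) where
  carrier := {f | ∀ a, f ∘ₗ V.act a = W.act a ∘ₗ f}
  add_mem' := fun hf hg a => by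
    rw [LinearMap.add_comp, LinearMap.comp_add, hf a, hg a]
  zero_mem' := fun a => by simp
  smul_mem' := fun c f hf a => by
    rw [LinearMap.smul_comp, LinearMap.comp_smul, hf a]

instance (V W : RightRep k A) : AddCommGroup (V ⟶ W) :=
  (show (V ⟶ W) ≃ equivariant k A V W from homEquiv V W).addCommGroup

instance (V W : RightRep k A) : Module k (V ⟶ W) :=
  (show (V ⟶ W) ≃ equivariant k A V W from homEquiv V W).module k

@[simp] lemma add_hom {V W : RightRep k A} (f g : V ⟶ W) : (f + g).hom = f.hom + g.hom := rfl

@[simp] lemma smul_hom {V W : RightRep k A} (c : k) (f : V ⟶ W) : (c • f).hom = c • f.hom := rfl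

instance : Preadditive (RightRep k A) where
  add_comp _ _ _ f f' g := by ext : 1; simp [LinearMap.comp_add]
  comp_add _ _ _ f g g' := by ext : 1; simp [LinearMap.add_comp]

instance : Linear k (RightRep k A) where
  smul_comp _ _ _ c f g := by ext : 1; simp [LinearMap.comp_smul]
  comp_smul _ _ _ f c g := by ext : 1; simp [LinearMap.smul_comp]

/-- Isomorphisms of right modules from equivariant linear equivalences. -/
@[simps]
def mkIso {V W : RightRep k A} (e : V ≃ₗ[k] W)
    (h : ∀ a, e.toLinearMap ∘ₗ V.act a = W.act a ∘ₗ e.toLinearMap) : V ≅ W where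
  hom := ⟨e.toLinearMap, h⟩
  inv := ⟨e.symm.toLinearMap, fun a => by
    ext w
    apply e.injective
    have := LinearMap.congr_fun (h a) (e.symm w)
    simp at this
    simp [this]⟩
  hom_inv_id := by ext; simp
  inv_hom_id := by ext; simp

/-- The forgetful functor to vector spaces. -/
def toModuleCat (k : Type u) [Field k] (A : Type u) [Ring A] [Algebra k A] :
    RightRep k A ⥤ ModuleCat.{u} k where
  obj V := ModuleCat.of k V
  map f := ModuleCat.ofHom f.hom

instance : (toModuleCat k A).Faithful where
  map_injective h := hom_ext (congrArg ModuleCat.Hom.hom h)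

end Category

section Monoidal

variable {k : Type u} [Field k] {A : Type u} [Ring A] [Bialgebra k A]

section PairAct

variable {V W X V' W' : Type u} [AddCommGroup V] [Module k V] [AddCommGroup W] [Module k W]
  [AddCommGroup X] [Module k X] [AddCommGroup V'] [Module k V'] [AddCommGroup W'] [Module k W']

/-- The componentwise right action of `A ⊗ A` on `V ⊗ W`: `(v ⊗ w) ↼ (a ⊗ b) = v ↼ a ⊗ w ↼ b`. -/
def pairAct (r : A →ₗ[k] Module.End k V) (s : A →ₗ[k] Module.End k W) :
    A ⊗[k] A →ₗ[k] Module.End k (V ⊗[k] W) :=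
  TensorProduct.map₂ r s

variable (r : A →ₗ[k] Module.End k V) (s : A →ₗ[k] Module.End k W) (q : A →ₗ[k] Module.End k X)
  (r' : A →ₗ[k] Module.End k V') (s' : A →ₗ[k] Module.End k W')

@[simp] lemma pairAct_tmul (a b : A) :
    pairAct r s (a ⊗ₜ b) = TensorProduct.map (r a) (s b) := rfl

lemma pairAct_mul (hr : ∀ a b, r (a * b) = r b ∘ₗ r a) (hs : ∀ a b, s (a * b) = s b ∘ₗ s a)
    (t t' : A ⊗[k] A) : pairAct r s (t * t') = pairAct r s t' ∘ₗ pairAct r s t := by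
  induction t with
  | zero => simp
  | add t₁ t₂ h₁ h₂ => simp only [add_mul, map_add, h₁, h₂, LinearMap.comp_add]
  | tmul a b =>
    induction t' with
    | zero => simp
    | add t₁ t₂ h₁ h₂ => simp only [mul_add, map_add, h₁, h₂, LinearMap.add_comp]
    | tmul c d => simp [hr, hs, TensorProduct.map_comp]

lemma pairAct_natural (f : V →ₗ[k] V') (g : W →ₗ[k] W') (hf : ∀ a, f ∘ₗ r a = r' a ∘ₗ f)
    (hg : ∀ a, g ∘ₗ s a = s' a ∘ₗ g) (t : A ⊗[k] A) :
    TensorProduct.map f g ∘ₗ pairAct r s t = pairAct r' s' t ∘ₗ TensorProduct.map f g := by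
  induction t with
  | zero => simp
  | add t₁ t₂ h₁ h₂ => simp only [map_add, LinearMap.comp_add, LinearMap.add_comp, h₁, h₂]
  | tmul a b => simp only [pairAct_tmul, ← TensorProduct.map_comp, hf, hg]

lemma pairAct_assoc (a : A) :
    (TensorProduct.assoc k V W X).toLinearMap ∘ₗ
        pairAct (pairAct r s ∘ₗ comul) q (comul a) =
      pairAct r (pairAct s q ∘ₗ comul) (comul a) ∘ₗ
        (TensorProduct.assoc k V W X).toLinearMap := by
  have h₁ : ∀ t : A ⊗[k] A, pairAct (pairAct r s ∘ₗ comul) q t =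
      TensorProduct.map₂ (pairAct r s) q (comul.rTensor A t) := by
    intro t
    induction t with
    | zero => simp
    | add t₁ t₂ h₁ h₂ => simp only [map_add, h₁, h₂]
    | tmul a b => simp
  have h₂ : ∀ t : A ⊗[k] A, pairAct r (pairAct s q ∘ₗ comul) t =
      TensorProduct.map₂ r (pairAct s q) (comul.lTensor A t) := by
    intro t
    induction t with
    | zero => simp
    | add t₁ t₂ h₁ h₂ => simp only [map_add, h₁, h₂]
    | tmul a b => simp
  have h₃ : ∀ t : (A ⊗[k] A) ⊗[k] A,
      (TensorProduct.assoc k V W X).toLinearMap ∘ₗ TensorProduct.map₂ (pairAct r s) q t =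
        TensorProduct.map₂ r (pairAct s q) (TensorProduct.assoc k A A A t) ∘ₗ
          (TensorProduct.assoc k V W X).toLinearMap := by
    intro t
    induction t with
    | zero => simp
    | add t₁ t₂ h₁ h₂ => simp only [map_add, LinearMap.comp_add, LinearMap.add_comp, h₁, h₂]
    | tmul t c =>
      induction t with
      | zero => simp
      | add t₁ t₂ h₁ h₂ =>
        simp only [TensorProduct.add_tmul, map_add, LinearMap.comp_add, LinearMap.add_comp, h₁, h₂]
      | tmul a b =>
        ext v w x
        simp
  rw [h₁, h₂, ← Coalgebra.coassoc_apply]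
  exact h₃ _

lemma pairAct_lid (a : A) :
    (TensorProduct.lid k V).toLinearMap ∘ₗ
        pairAct ((counit : A →ₗ[k] k).smulRight LinearMap.id) r (comul a) =
      r a ∘ₗ (TensorProduct.lid k V).toLinearMap := by
  have h : ∀ t : A ⊗[k] A, (TensorProduct.lid k V).toLinearMap ∘ₗ
        pairAct ((counit : A →ₗ[k] k).smulRight LinearMap.id) r t =
      r (TensorProduct.lid k A (counit.rTensor A t)) ∘ₗ (TensorProduct.lid k V).toLinearMap := by
    intro t
    induction t with
    | zero => simp
    | add t₁ t₂ h₁ h₂ => simp only [map_add, LinearMap.comp_add, LinearMap.add_comp, h₁, h₂]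
    | tmul a b =>
      ext v
      simp
  rw [h]
  simp

lemma pairAct_rid (a : A) :
    (TensorProduct.rid k V).toLinearMap ∘ₗ
        pairAct r ((counit : A →ₗ[k] k).smulRight LinearMap.id) (comul a) =
      r a ∘ₗ (TensorProduct.rid k V).toLinearMap := by
  have h : ∀ t : A ⊗[k] A, (TensorProduct.rid k V).toLinearMap ∘ₗ
        pairAct r ((counit : A →ₗ[k] k).smulRight LinearMap.id) t =
      r (TensorProduct.rid k A (counit.lTensor A t)) ∘ₗ (TensorProduct.rid k V).toLinearMap := by
    intro t
    induction t with
    | zero => simp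
    | add t₁ t₂ h₁ h₂ => simp only [map_add, LinearMap.comp_add, LinearMap.add_comp, h₁, h₂]
    | tmul a b =>
      ext v
      simp
  rw [h]
  simp

end PairAct

/-- The tensor product of right modules, with the diagonal action
`(v ⊗ w) ↼ a = v ↼ a₍₁₎ ⊗ w ↼ a₍₂₎`. -/
abbrev tensor (V W : RightRep k A) : RightRep k A where
  carrier := V ⊗[k] W
  act := pairAct V.act W.act ∘ₗ comul
  act_one := by simp [Algebra.TensorProduct.one_def, act_one]
  act_mul a b := by
    simp only [LinearMap.comp_apply, Bialgebra.comul_mul, pairAct_mul _ _ V.act_mul W.act_mul]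

/-- The ground field as a right module through the counit. -/
abbrev unit (k : Type u) [Field k] (A : Type u) [Ring A] [Bialgebra k A] : RightRep k A where
  carrier := k
  act := (counit : A →ₗ[k] k).smulRight LinearMap.id
  act_one := by simp
  act_mul a b := by ext; simp [mul_comm]

instance : MonoidalCategoryStruct (RightRep k A) where
  tensorObj := tensor
  tensorUnit := unit k A
  whiskerLeft V _ _ f := ⟨f.hom.lTensor V, fun a =>
    pairAct_natural _ _ _ _ LinearMap.id f.hom (fun _ => rfl) f.comm (comul a)⟩
  whiskerRight f W := ⟨f.hom.rTensor W, fun a =>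
    pairAct_natural _ _ _ _ f.hom LinearMap.id f.comm (fun _ => rfl) (comul a)⟩
  tensorHom f g := ⟨TensorProduct.map f.hom g.hom, fun a =>
    pairAct_natural _ _ _ _ f.hom g.hom f.comm g.comm (comul a)⟩
  associator V W X := mkIso (TensorProduct.assoc k V W X) (pairAct_assoc V.act W.act X.act)
  leftUnitor V := mkIso (TensorProduct.lid k V) (pairAct_lid V.act)
  rightUnitor V := mkIso (TensorProduct.rid k V) (pairAct_rid V.act)

instance : MonoidalCategory (RightRep k A) :=
  Monoidal.induced (toModuleCat k A)
    { μIso := fun _ _ => Iso.refl _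
      εIso := Iso.refl _
      whiskerLeft_eq := fun _ _ _ _ => by ext : 1; exact TensorProduct.ext' fun _ _ => rfl
      whiskerRight_eq := fun _ _ => by ext : 1; exact TensorProduct.ext' fun _ _ => rfl
      tensorHom_eq := fun _ _ => by ext : 1; exact TensorProduct.ext' fun _ _ => rfl
      associator_eq := fun _ _ _ => by ext : 1; exact TensorProduct.ext_threefold fun _ _ _ => rfl
      leftUnitor_eq := fun _ => by ext : 1; exact TensorProduct.ext' fun _ _ => rfl
      rightUnitor_eq := fun _ => by ext : 1; exact TensorProduct.ext' fun _ _ => rfl }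

end Monoidal

section Restriction

variable {k : Type u} [Field k] {A B : Type u} [Ring A] [Ring B] [Bialgebra k A] [Bialgebra k B]

/-- Restriction of right modules along a homomorphism of bialgebras. -/
def res (i : A →ₐc[k] B) : RightRep k B ⥤ RightRep k A where
  obj V :=
    { carrier := V
      act := V.act ∘ₗ (i : A →ₗ[k] B)
      act_one := by simpa using V.act_one
      act_mul := fun a b => by simpa using V.act_mul (i a) (i b) }
  map f := ⟨f.hom, fun a => f.comm (i a)⟩

lemma pairAct_comp {V W : Type u} [AddCommGroup V] [Module k V] [AddCommGroup W] [Module k W]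
    (r : B →ₗ[k] Module.End k V) (s : B →ₗ[k] Module.End k W) (i : A →ₐc[k] B) (a : A) :
    pairAct (r ∘ₗ (i : A →ₗ[k] B)) (s ∘ₗ (i : A →ₗ[k] B)) (comul a) =
      pairAct r s (comul (i a)) := by
  have h : ∀ t : A ⊗[k] A, pairAct (r ∘ₗ (i : A →ₗ[k] B)) (s ∘ₗ (i : A →ₗ[k] B)) t =
      pairAct r s (TensorProduct.map (i : A →ₗ[k] B) (i : A →ₗ[k] B) t) := by
    intro t
    induction t with
    | zero => simp
    | add t₁ t₂ h₁ h₂ => simp only [map_add, h₁, h₂]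
    | tmul a b => simp
  rw [h]
  congr 1
  exact CoalgHomClass.map_comp_comul_apply i a

/-- Restriction is strictly compatible with tensor products and unit objects; its monoidal structure
is given by identity maps. -/
instance (i : A →ₐc[k] B) : (res i).Monoidal :=
  Functor.CoreMonoidal.toMonoidal
    { εIso := mkIso (LinearEquiv.refl k k) fun a =>
        LinearMap.ext fun c => show (counit a : k) • c = (counit (i a) : k) • c by simp
      μIso := fun V W => mkIso (LinearEquiv.refl k (V ⊗[k] W))
        fun a => pairAct_comp V.act W.act i a
      μIso_hom_natural_left := fun _ _ => by ext : 1; exact TensorProduct.ext' fun _ _ => rfl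
      μIso_hom_natural_right := fun _ _ => by ext : 1; exact TensorProduct.ext' fun _ _ => rfl
      associativity := fun _ _ _ => by ext : 1; exact TensorProduct.ext_threefold fun _ _ _ => rfl
      left_unitality := fun _ => by ext : 1; exact TensorProduct.ext' fun _ _ => rfl
      right_unitality := fun _ => by ext : 1; exact TensorProduct.ext' fun _ _ => rfl }

end Restriction
end RightRep

/-! ### Extensions of Hopf algebras and bicrossed products -/

section Extensions

variable {k : Type u} [Field k] {K H Q : Type u} [Ring K] [Ring H] [Ring Q]

/-- Exactness of a sequence `k → K → H → Q → k` of Hopf algebras: `i` is injective, `π` is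
surjective, `ker π = H i(K)⁺` and `i(K)` consists of the coinvariants of `π`. -/
structure IsHopfExact [HopfAlgebra k K] [HopfAlgebra k H] [HopfAlgebra k Q]
    (i : K →ₐc[k] H) (π : H →ₐc[k] Q) : Prop where
  injective : Function.Injective i
  surjective : Function.Surjective π
  ker_eq : {h : H | π h = 0} = Ideal.span (i '' {a : K | (counit a : k) = 0})
  range_eq : Set.range i = {h : H | (π : H →ₗ[k] Q).lTensor H (comul h) = h ⊗ₜ[k] (1 : Q)}

/-- Multiplication on the left tensor factor: `a ⊗ (b ⊗ x) ↦ a b ⊗ x`. -/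
noncomputable def leftMul (k : Type u) [Field k] (K Q : Type u) [Ring K] [Algebra k K]
    [AddCommGroup Q] [Module k Q] : K ⊗[k] (K ⊗[k] Q) →ₗ[k] K ⊗[k] Q :=
  (LinearMap.mul' k K).rTensor Q ∘ₗ (TensorProduct.assoc k K K Q).symm.toLinearMap

@[simp] lemma leftMul_tmul [Algebra k K] [Algebra k Q] (a b : K) (x : Q) :
    leftMul k K Q (a ⊗ₜ (b ⊗ₜ x)) = (a * b) ⊗ₜ x := by
  simp [leftMul]

/-- The data `(., σ, ρ, τ)` of a cleft extension of `K` by `Q`: a weak action and a weak coaction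
with a normalized map `σ` and a conormalized map `τ`. -/
structure CleftData (k : Type u) [Field k] (K Q : Type u) [Ring K] [Ring Q] [Bialgebra k K]
    [Bialgebra k Q] where
  /-- the weak action `x . a` -/
  act : Q →ₗ[k] K →ₗ[k] K
  /-- the cocycle `σ(x, y)` -/
  σ : Q →ₗ[k] Q →ₗ[k] K
  /-- the weak coaction `ρ(x) = x₍₀₎ ⊗ x₍₁₎` -/
  ρ : Q →ₗ[k] Q ⊗[k] K
  /-- the dual cocycle `τ(x)` -/
  τ : Q →ₗ[k] K ⊗[k] K
  one_act : ∀ a, act 1 a = a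
  act_one : ∀ x, act x 1 = algebraMap k K (counit x)
  /-- `x . (a b) = (x₍₁₎ . a) (x₍₂₎ . b)` -/
  act_mul : ∀ x a b, act x (a * b) =
    LinearMap.mul' k K (TensorProduct.map (act.flip a) (act.flip b) (comul x))
  σ_one_left : ∀ x, σ 1 x = algebraMap k K (counit x)
  σ_one_right : ∀ x, σ x 1 = algebraMap k K (counit x)
  /-- `x₍₀₎ ε(x₍₁₎) = x` -/
  ρ_counit : ∀ x, TensorProduct.rid k Q ((counit (R := k) (A := K)).lTensor Q (ρ x)) = x
  /-- `ε(x₍₀₎) x₍₁₎ = ε(x) 1` -/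
  counit_ρ : ∀ x, TensorProduct.lid k K ((counit (R := k) (A := Q)).rTensor K (ρ x)) =
    algebraMap k K (counit x)
  /-- `(x₍₀₎)₍₁₎ ⊗ (x₍₀₎)₍₂₎ ⊗ x₍₁₎ = (x₍₁₎)₍₀₎ ⊗ (x₍₂₎)₍₀₎ ⊗ (x₍₁₎)₍₁₎ (x₍₂₎)₍₁₎` -/
  comul_ρ : ∀ x, (comul (R := k) (A := Q)).rTensor K (ρ x) =
    (LinearMap.mul' k K).lTensor (Q ⊗[k] Q)
      (TensorProduct.tensorTensorTensorComm k Q K Q K (TensorProduct.map ρ ρ (comul x)))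
  counit_τ : ∀ x, TensorProduct.lid k K ((counit (R := k) (A := K)).rTensor K (τ x)) =
    algebraMap k K (counit x)
  τ_counit : ∀ x, TensorProduct.rid k K ((counit (R := k) (A := K)).lTensor K (τ x)) =
    algebraMap k K (counit x)

namespace CleftData

section Formulas

variable [Bialgebra k K] [Bialgebra k Q] (D : CleftData k K Q)

/-- The map `x ↦ (x₍₁₎ . a) ⊗ x₍₂₎`. -/
noncomputable def cross (a : K) : Q →ₗ[k] K ⊗[k] Q :=
  (D.act.flip a).rTensor Q ∘ₗ comul

lemma cross_apply (a : K) {x : Q} {ι : Type*} (r : Coalgebra.Repr k x ι) :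
    D.cross a x = ∑ j ∈ r.index, D.act (r.left j) a ⊗ₜ r.right j := by
  simp [cross, ← r.eq]

/-- The map `(x, y) ↦ σ(x₍₁₎, y₍₁₎) ⊗ x₍₂₎ y₍₂₎`. -/
noncomputable def twistedMul : Q →ₗ[k] Q →ₗ[k] K ⊗[k] Q :=
  TensorProduct.curry
    (TensorProduct.map (TensorProduct.lift D.σ) (LinearMap.mul' k Q) ∘ₗ
      (TensorProduct.tensorTensorTensorComm k Q Q Q Q).toLinearMap ∘ₗ
        TensorProduct.map comul comul)

lemma twistedMul_apply {x y : Q} {ι κ : Type*} (r : Coalgebra.Repr k x ι)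
    (s : Coalgebra.Repr k y κ) :
    D.twistedMul x y = ∑ j ∈ r.index, ∑ l ∈ s.index,
      D.σ (r.left j) (s.left l) ⊗ₜ (r.right j * s.right l) := by
  simp [twistedMul, ← r.eq, ← s.eq, TensorProduct.sum_tmul, TensorProduct.tmul_sum]
  exact Finset.sum_comm

/-- The map `(s ⊗ t) ⊗ ((y ⊗ b) ⊗ z) ↦ (s ⊗ y) ⊗ (t b ⊗ z)`. -/
noncomputable def shuffle (k : Type u) [Field k] (K Q : Type u) [Ring K] [Ring Q] [Algebra k K]
    [Algebra k Q] :
    (K ⊗[k] K) ⊗[k] ((Q ⊗[k] K) ⊗[k] Q) →ₗ[k] (K ⊗[k] Q) ⊗[k] (K ⊗[k] Q) :=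
  (leftMul k K Q).lTensor (K ⊗[k] Q) ∘ₗ
    (TensorProduct.tensorTensorTensorComm k K K Q (K ⊗[k] Q)).toLinearMap ∘ₗ
      (TensorProduct.assoc k Q K Q).toLinearMap.lTensor (K ⊗[k] K)

@[simp] lemma shuffle_tmul (s t b : K) (y z : Q) :
    shuffle k K Q ((s ⊗ₜ t) ⊗ₜ ((y ⊗ₜ b) ⊗ₜ z)) = (s ⊗ₜ y) ⊗ₜ ((t * b) ⊗ₜ z) := by
  simp [shuffle]

/-- The map `x ↦ τ(x₍₁₎) (1 ⊗ (x₍₂₎)₍₀₎ ⊗ (x₍₂₎)₍₁₎ ⊗ x₍₃₎)` into `(K ⊗ Q) ⊗ (K ⊗ Q)`: if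
`τ(x₍₁₎) = s ⊗ t` and `ρ(x₍₂₎) = y ⊗ b`, the term is `(s ⊗ y) ⊗ (t b ⊗ x₍₃₎)`. -/
noncomputable def twistedComul : Q →ₗ[k] (K ⊗[k] Q) ⊗[k] (K ⊗[k] Q) :=
  shuffle k K Q ∘ₗ TensorProduct.map D.τ (D.ρ.rTensor Q ∘ₗ comul) ∘ₗ comul

lemma twistedComul_apply {x : Q} {ι κ : Type*} (r : Coalgebra.Repr k x ι)
    (s : ∀ j, Coalgebra.Repr k (r.right j) κ) :
    D.twistedComul x = ∑ j ∈ r.index, ∑ l ∈ (s j).index,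
      shuffle k K Q (D.τ (r.left j) ⊗ₜ (D.ρ ((s j).left l) ⊗ₜ (s j).right l)) := by
  simp [twistedComul, ← r.eq, ← (s _).eq, TensorProduct.tmul_sum]

end Formulas

/-- `H` is, through `Φ`, the bicrossed product `K ^τ#_σ Q` of the data `D`, with `i` the inclusion
`a ↦ a # 1` and `π` the projection `a # x ↦ ε(a) x`. -/
structure IsBicrossedProduct [HopfAlgebra k K] [HopfAlgebra k H] [HopfAlgebra k Q]
    (D : CleftData k K Q) (i : K →ₐc[k] H) (π : H →ₐc[k] Q) (Φ : K ⊗[k] Q ≃ₗ[k] H) : Prop where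
  /-- `(a # x)(b # y) = a (x₍₁₎ . b) σ(x₍₂₎, y₍₁₎) # x₍₃₎ y₍₂₎` -/
  map_mul : ∀ a b x y, Φ (a ⊗ₜ x) * Φ (b ⊗ₜ y) =
    Φ (leftMul k K Q (a ⊗ₜ leftMul k K Q ((D.twistedMul.flip y).lTensor K (D.cross b x))))
  /-- `Δ(a # x) = Δ(a) τ(x₍₁₎) (1 # (x₍₂₎)₍₀₎ ⊗ (x₍₂₎)₍₁₎ # x₍₃₎)` -/
  map_comul : ∀ a x, comul (Φ (a ⊗ₜ x)) =
    TensorProduct.map (Φ : K ⊗[k] Q →ₗ[k] H) (Φ : K ⊗[k] Q →ₗ[k] H)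
      (TensorProduct.map (leftMul k K Q) (leftMul k K Q)
        (TensorProduct.tensorTensorTensorComm k K K (K ⊗[k] Q) (K ⊗[k] Q)
          (comul a ⊗ₜ D.twistedComul x)))
  map_one : Φ (1 ⊗ₜ 1) = 1
  map_counit : ∀ a x, (counit (Φ (a ⊗ₜ x)) : k) = counit a * counit x
  inclusion : ∀ a, Φ (a ⊗ₜ 1) = i a
  projection : ∀ a x, π (Φ (a ⊗ₜ x)) = (counit a : k) • x

/-! ### The explicit Hopf monad -/

section Monad

variable [Bialgebra k K] [Bialgebra k Q] (D : CleftData k K Q)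

/-- The map `w ⊗ (a ⊗ x) ↦ w ↼ a ⊗ x`. -/
noncomputable def actLeft (Q : Type u) [AddCommGroup Q] [Module k Q] (W : RightRep k K) :
    W ⊗[k] (K ⊗[k] Q) →ₗ[k] W ⊗[k] Q :=
  (TensorProduct.lift W.act.flip).rTensor Q ∘ₗ (TensorProduct.assoc k W K Q).symm.toLinearMap

@[simp] lemma actLeft_tmul (W : RightRep k K) (w : W) (a : K) (x : Q) :
    actLeft Q W (w ⊗ₜ (a ⊗ₜ x)) = W.act a w ⊗ₜ x := by
  simp [actLeft]

/-- The action of `K` on `W ⊗ Q`: `(w ⊗ x) ↼ a = w ↼ (x₍₁₎ . a) ⊗ x₍₂₎`. -/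
noncomputable def tAct (W : RightRep k K) : K →ₗ[k] Module.End k (W ⊗[k] Q) where
  toFun a := actLeft Q W ∘ₗ (D.cross a).lTensor W
  map_add' a b := by
    refine TensorProduct.ext' fun w x => ?_
    simp [cross, LinearMap.rTensor_add, TensorProduct.tmul_add]
  map_smul' c a := by
    refine TensorProduct.ext' fun w x => ?_
    simp [cross, LinearMap.rTensor_smul]

lemma tAct_tmul (W : RightRep k K) (a : K) (w : W) {x : Q} {ι : Type*} (r : Coalgebra.Repr k x ι) :
    D.tAct W a (w ⊗ₜ x) = ∑ j ∈ r.index, W.act (D.act (r.left j) a) w ⊗ₜ r.right j := by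
  simp [tAct, D.cross_apply a r, TensorProduct.tmul_sum]

lemma tAct_one (W : RightRep k K) : D.tAct W 1 = LinearMap.id := by
  refine TensorProduct.ext' fun w x => ?_
  have h : D.cross 1 x = 1 ⊗ₜ x := by
    have : ∀ t : Q ⊗[k] Q, (D.act.flip 1).rTensor Q t =
        (Algebra.linearMap k K).rTensor Q ((counit (R := k) (A := Q)).rTensor Q t) := by
      intro t
      induction t with
      | zero => simp
      | add t₁ t₂ h₁ h₂ => simp only [map_add, h₁, h₂]
      | tmul y z => simp [D.act_one]
    change (D.act.flip 1).rTensor Q (comul x) = _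
    rw [this, Coalgebra.rTensor_counit_comul]
    simp
  change actLeft Q W (w ⊗ₜ D.cross 1 x) = _
  rw [h, actLeft_tmul, W.act_one]
  rfl

lemma tAct_mul (W : RightRep k K) (a b : K) : D.tAct W (a * b) = D.tAct W b ∘ₗ D.tAct W a := by
  refine TensorProduct.ext' fun w x => ?_
  let G : (Q ⊗[k] Q) ⊗[k] Q →ₗ[k] W ⊗[k] Q :=
    (W.act.flip w ∘ₗ LinearMap.mul' k K ∘ₗ
      TensorProduct.map (D.act.flip a) (D.act.flip b)).rTensor Q
  have h₁ : ∀ t : Q ⊗[k] Q, actLeft Q W (w ⊗ₜ (D.act.flip (a * b)).rTensor Q t) =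
      G (comul.rTensor Q t) := by
    intro t
    induction t with
    | zero => simp
    | add t₁ t₂ h₁ h₂ => simp only [map_add, TensorProduct.tmul_add, h₁, h₂]
    | tmul y z => simp [G, D.act_mul]
  have h₃ : ∀ (y : Q) (t : Q ⊗[k] Q),
      actLeft Q W (W.act (D.act y a) w ⊗ₜ (D.act.flip b).rTensor Q t) =
        G ((TensorProduct.assoc k Q Q Q).symm (y ⊗ₜ t)) := by
    intro y t
    induction t with
    | zero => simp
    | add t₁ t₂ h₁ h₂ => simp only [map_add, TensorProduct.tmul_add, h₁, h₂]
    | tmul z z' => simp [G, W.act_mul]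
  have h₂ : ∀ t : Q ⊗[k] Q, D.tAct W b (actLeft Q W (w ⊗ₜ (D.act.flip a).rTensor Q t)) =
      G ((TensorProduct.assoc k Q Q Q).symm (comul.lTensor Q t)) := by
    intro t
    induction t with
    | zero => simp
    | add t₁ t₂ h₁ h₂ => simp only [map_add, TensorProduct.tmul_add, h₁, h₂]
    | tmul y z =>
      simp only [LinearMap.rTensor_tmul, LinearMap.flip_apply, actLeft_tmul,
        LinearMap.lTensor_tmul]
      exact h₃ y (comul z)
  change actLeft Q W (w ⊗ₜ (D.act.flip (a * b)).rTensor Q (comul x)) =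
    D.tAct W b (actLeft Q W (w ⊗ₜ (D.act.flip a).rTensor Q (comul x)))
  rw [h₁, h₂, Coalgebra.coassoc_symm_apply]

lemma tAct_natural {W U : RightRep k K} (f : W ⟶ U) (a : K) :
    f.hom.rTensor Q ∘ₗ D.tAct W a = D.tAct U a ∘ₗ f.hom.rTensor Q := by
  refine TensorProduct.ext' fun w x => ?_
  have h : ∀ t : K ⊗[k] Q, f.hom.rTensor Q (actLeft Q W (w ⊗ₜ t)) =
      actLeft Q U (f.hom w ⊗ₜ t) := by
    intro t
    induction t with
    | zero => simp
    | add t₁ t₂ h₁ h₂ => simp only [map_add, TensorProduct.tmul_add, h₁, h₂]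
    | tmul b y =>
      have := LinearMap.congr_fun (f.comm b) w
      simp only [LinearMap.comp_apply] at this
      simp [this]
  exact h _

/-- The right `K`-module `T(W) = W ⊗ Q`, with `(w ⊗ x) ↼ a = w ↼ (x₍₁₎ . a) ⊗ x₍₂₎`. -/
noncomputable abbrev tObj [FiniteDimensional k Q] (W : RightRep k K) : RightRep k K where
  carrier := W ⊗[k] Q
  act := D.tAct W
  act_one := D.tAct_one W
  act_mul a b := D.tAct_mul W a b

/-- The endofunctor `T` of the category of finite-dimensional right `K`-modules. -/
noncomputable def T [FiniteDimensional k Q] : RightRep k K ⥤ RightRep k K where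
  obj W := D.tObj W
  map f := ⟨f.hom.rTensor Q, D.tAct_natural f⟩
  map_id W := by ext : 1; exact LinearMap.rTensor_id Q W
  map_comp f g := by ext : 1; exact LinearMap.rTensor_comp Q g.hom f.hom

/-- `μ_W (w ⊗ x ⊗ y) = w ↼ σ(x₍₁₎, y₍₁₎) ⊗ x₍₂₎ y₍₂₎`. -/
noncomputable def muMap (W : RightRep k K) : (W ⊗[k] Q) ⊗[k] Q →ₗ[k] W ⊗[k] Q :=
  actLeft Q W ∘ₗ (TensorProduct.lift D.twistedMul).lTensor W ∘ₗ
    (TensorProduct.assoc k W Q Q).toLinearMap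

lemma muMap_tmul (W : RightRep k K) (w : W) {x y : Q} {ι κ : Type*} (r : Coalgebra.Repr k x ι)
    (s : Coalgebra.Repr k y κ) :
    D.muMap W ((w ⊗ₜ x) ⊗ₜ y) = ∑ j ∈ r.index, ∑ l ∈ s.index,
      W.act (D.σ (r.left j) (s.left l)) w ⊗ₜ (r.right j * s.right l) := by
  simp [muMap, D.twistedMul_apply r s, TensorProduct.tmul_sum]

/-- `ξ_{W,U} (w ⊗ u ⊗ x) = (w ⊗ u) ↼ τ(x₍₁₎) (1 ⊗ (x₍₂₎)₍₁₎) ⊗ (x₍₂₎)₍₀₎ ⊗ x₍₃₎`, where the last two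
factors belong to `W` and `U` respectively: if `τ(x₍₁₎) = s ⊗ t` and `ρ(x₍₂₎) = y ⊗ b`, the term is
`(w ↼ s ⊗ y) ⊗ (u ↼ (t b) ⊗ x₍₃₎)`. -/
noncomputable def xiMap (W U : RightRep k K) :
    (W ⊗[k] U) ⊗[k] Q →ₗ[k] (W ⊗[k] Q) ⊗[k] (U ⊗[k] Q) :=
  TensorProduct.map (actLeft Q W) (actLeft Q U) ∘ₗ
    (TensorProduct.tensorTensorTensorComm k W U (K ⊗[k] Q) (K ⊗[k] Q)).toLinearMap ∘ₗ
      D.twistedComul.lTensor (W ⊗[k] U)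

lemma xiMap_tmul (W U : RightRep k K) (w : W) (u : U) {x : Q} {ι κ ν₁ ν₂ : Type*}
    (r : Coalgebra.Repr k x ι) (r' : ∀ j, Coalgebra.Repr k (r.right j) κ)
    (I : ι → Finset ν₁) (s t : ι → ν₁ → K)
    (hτ : ∀ j, D.τ (r.left j) = ∑ m ∈ I j, s j m ⊗ₜ t j m)
    (J : ι → κ → Finset ν₂) (y : ι → κ → ν₂ → Q) (b : ι → κ → ν₂ → K)
    (hρ : ∀ j l, D.ρ ((r' j).left l) = ∑ n ∈ J j l, y j l n ⊗ₜ b j l n) :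
    D.xiMap W U ((w ⊗ₜ u) ⊗ₜ x) = ∑ j ∈ r.index, ∑ l ∈ (r' j).index, ∑ m ∈ I j, ∑ n ∈ J j l,
      (W.act (s j m) w ⊗ₜ y j l n) ⊗ₜ (U.act (t j m * b j l n) u ⊗ₜ (r' j).right l) := by
  simp only [xiMap, LinearMap.comp_apply, LinearMap.lTensor_tmul, D.twistedComul_apply r r', hτ, hρ,
    TensorProduct.tmul_sum, TensorProduct.sum_tmul, map_sum, shuffle_tmul, LinearEquiv.coe_coe,
    TensorProduct.tensorTensorTensorComm_tmul, TensorProduct.map_tmul, actLeft_tmul]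
  refine Finset.sum_congr rfl fun j _ => Finset.sum_congr rfl fun l _ => ?_
  exact Finset.sum_comm

/-- `η_W(w) = w ⊗ 1`. -/
noncomputable def etaMap (W : RightRep k K) : W →ₗ[k] W ⊗[k] Q :=
  (TensorProduct.mk k W Q).flip 1

variable (k Q) in
/-- `φ = id ⊗ ε : k ⊗ Q → k`. -/
noncomputable def phiMap : k ⊗[k] Q →ₗ[k] k :=
  (TensorProduct.rid k k).toLinearMap ∘ₗ (counit : Q →ₗ[k] k).lTensor k

end Monad

end CleftData

end Extensions

/-!
The functor `T` is the composite of induction `W ↦ W ⊗_K H` and restriction along `i : K → H`.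
In a bicrossed product every element of `H` is `a # x = i(a) (1 # x)`, so `H` is free as a left
`K`-module on the elements `1 # x` and `W ⊗_K H` is `W ⊗ Q` as a vector space, `w ⊗ (a # x)` being
`w ↼ a ⊗ x` (`toInduced`). Under this identification the restriction of `W ⊗_K H` is `T W`, because
`(1 # x) i(a) = (x₍₁₎ . a) # x₍₂₎`. The Hopf monad of the adjunction between induction and
restriction, transported to `T` along this identity map (`BimonadStructure.ofIso`), has the stated
structure maps: its multiplication is governed by the products `(1 # x)(1 # y)`, that is by `σ`,
and its comonoidal structure by the coproduct `Δ(1 # x)`, that is by `τ` and `ρ`. Since left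
adjoints are unique up to an isomorphism which respects all structure
(`Adjunction.isBimonadIso_leftAdjointUniq`), the same Hopf monad is obtained from any left adjoint
of the restriction functor.

In terms of representatives, the left fusion operator is `(w ⊗ v) ⊗ h ↦ (w ⊗ h₍₁₎) ⊗ v ↼ h₍₂₎` and
the right one is `(v ⊗ w) ⊗ h ↦ v ↼ h₍₁₎ ⊗ (w ⊗ h₍₂₎)`. They are surjective by means of the inverse
of the antipode of `H` and of the antipode itself, respectively, and a comparison of dimensions
makes them bijective. The antipode of a finite-dimensional Hopf algebra is injective
(`HopfAlgebra.antipode_injective`) because there is a nonzero left integral.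

The functor `T` is right exact because induction and restriction are both left adjoints:
restriction is left adjoint to coinduction. That `T 𝟙` is trivial comes from
`ε(x . a) = ε(x) ε(a)`, obtained by applying `ε` to `(1 # x) i(a)`.
-/

/-! ### Transport of bimonad structures -/

section Transport

variable {C : Type u} [Category.{v} C] [MonoidalCategory C]

open Functor.OplaxMonoidal

namespace BimonadStructure

variable {T T' T'' : C ⥤ C}

/-- A comonoidal structure, transported along an isomorphism of functors. -/
abbrev oplaxOfIso (h : T'.OplaxMonoidal) (θ : T ≅ T') : T.OplaxMonoidal where
  η := θ.hom.app (𝟙_ C) ≫ η T'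
  δ X Y := θ.hom.app (X ⊗ Y) ≫ δ T' X Y ≫ (θ.inv.app X ⊗ₘ θ.inv.app Y)
  δ_natural_left f X := by
    have h := δ_natural_left T' f X
    simp only [← tensorHom_id, Category.assoc, NatTrans.naturality_assoc] at h ⊢
    rw [← reassoc_of% h]
    simp only [tensorHom_comp_tensorHom, Category.id_comp, Category.comp_id, NatTrans.naturality]
  δ_natural_right X f := by
    have h := δ_natural_right T' X f
    simp only [← id_tensorHom, Category.assoc, NatTrans.naturality_assoc] at h ⊢
    rw [← reassoc_of% h]
    simp only [tensorHom_comp_tensorHom, Category.id_comp, Category.comp_id, NatTrans.naturality]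
  oplax_associativity X Y Z := by
    have h := oplax_associativity (F := T') X Y Z
    simp only [← tensorHom_id, ← id_tensorHom, Category.assoc, tensorHom_comp_tensorHom_assoc,
      NatTrans.naturality_assoc, tensorHom_comp_tensorHom, Iso.inv_hom_id_app_assoc,
      Category.comp_id] at h ⊢
    have h₁ : (δ T' X Y ≫ (θ.inv.app X ⊗ₘ θ.inv.app Y)) ⊗ₘ θ.inv.app Z =
        (δ T' X Y ⊗ₘ 𝟙 (T'.obj Z)) ≫ ((θ.inv.app X ⊗ₘ θ.inv.app Y) ⊗ₘ θ.inv.app Z) := by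
      rw [tensorHom_comp_tensorHom, Category.id_comp]
    have h₂ : θ.inv.app X ⊗ₘ (δ T' Y Z ≫ (θ.inv.app Y ⊗ₘ θ.inv.app Z)) =
        (𝟙 (T'.obj X) ⊗ₘ δ T' Y Z) ≫ (θ.inv.app X ⊗ₘ (θ.inv.app Y ⊗ₘ θ.inv.app Z)) := by
      rw [tensorHom_comp_tensorHom, Category.id_comp]
    rw [h₁, h₂, Category.assoc, associator_naturality, reassoc_of% h]
  oplax_left_unitality X := by
    have h := oplax_left_unitality (F := T') X
    simp only [← tensorHom_id, Category.assoc, NatTrans.naturality_assoc,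
      tensorHom_comp_tensorHom, Iso.inv_hom_id_app_assoc, Category.comp_id] at h ⊢
    have h₁ : η T' ⊗ₘ θ.inv.app X = (η T' ⊗ₘ 𝟙 _) ≫ (𝟙 _ ⊗ₘ θ.inv.app X) := by
      rw [tensorHom_comp_tensorHom, Category.id_comp, Category.comp_id]
    rw [h₁, ← reassoc_of% h, id_tensorHom, ← leftUnitor_inv_naturality]
    simp
  oplax_right_unitality X := by
    have h := oplax_right_unitality (F := T') X
    simp only [← id_tensorHom, Category.assoc, NatTrans.naturality_assoc,
      tensorHom_comp_tensorHom, Iso.inv_hom_id_app_assoc, Category.comp_id] at h ⊢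
    have h₁ : θ.inv.app X ⊗ₘ η T' = (𝟙 _ ⊗ₘ η T') ≫ (θ.inv.app X ⊗ₘ 𝟙 _) := by
      rw [tensorHom_comp_tensorHom, Category.id_comp, Category.comp_id]
    rw [h₁, ← reassoc_of% h, tensorHom_id, ← rightUnitor_inv_naturality]
    simp

/-- The multiplication of a bimonad, transported along an isomorphism of functors. -/
@[simps]
def muOfIso (S : BimonadStructure T') (θ : T ≅ T') : T ⋙ T ⟶ T where
  app X := T.map (θ.hom.app X) ≫ θ.hom.app (T'.obj X) ≫ S.mu.app X ≫ θ.inv.app X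
  naturality X Y f := by
    have h := S.mu.naturality f
    simp only [Functor.comp_map] at h
    simp only [Functor.comp_map, Category.assoc, ← θ.inv.naturality, ← reassoc_of% h,
      ← θ.hom.naturality_assoc, ← T.map_comp_assoc, θ.hom.naturality]

/-- A bimonad structure, transported along an isomorphism of functors. -/
def ofIso (S : BimonadStructure T') (θ : T ≅ T') : BimonadStructure T where
  mu := S.muOfIso θ
  unit := S.unit ≫ θ.inv
  comonoidal := oplaxOfIso S.comonoidal θ
  assoc X := by
    rw [← cancel_mono (θ.hom.app X)]
    have h := S.assoc X
    have h' := (S.muOfIso θ).naturality (θ.hom.app X)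
    simp only [Functor.comp_map] at h'
    simp only [Category.assoc]
    have h₁ : (S.muOfIso θ).app X ≫ θ.hom.app X =
        T.map (θ.hom.app X) ≫ θ.hom.app (T'.obj X) ≫ S.mu.app X := by simp
    rw [h₁, ← reassoc_of% h', ← T.map_comp_assoc, h₁]
    have h₂ := θ.hom.naturality (θ.hom.app X)
    simp only [Functor.map_comp, Category.assoc, NatTrans.naturality_assoc, muOfIso_app, h,
      Iso.inv_hom_id_app_assoc]
    rw [← T'.map_comp_assoc, ← T'.map_comp_assoc, h₂]
    rfl
  left_unit X := by
    have h := S.left_unit X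
    have h' := S.unit.naturality (θ.hom.app X)
    simp only [Functor.id_map] at h'
    simp only [NatTrans.comp_app, muOfIso_app, Category.assoc, ← θ.inv.naturality_assoc,
      Iso.inv_hom_id_app_assoc]
    rw [← reassoc_of% h', reassoc_of% h]
    exact θ.hom_inv_id_app X
  right_unit X := by
    have h := S.right_unit X
    rw [← cancel_mono (θ.hom.app X)]
    simp [h]
  mu_xi X Y := by
    have h := S.mu_xi X Y
    let := S.comonoidal
    change (S.muOfIso θ).app (X ⊗ Y) ≫
        θ.hom.app (X ⊗ Y) ≫ δ T' X Y ≫ (θ.inv.app X ⊗ₘ θ.inv.app Y) =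
      T.map (θ.hom.app (X ⊗ Y) ≫ δ T' X Y ≫ (θ.inv.app X ⊗ₘ θ.inv.app Y)) ≫
        (θ.hom.app (T.obj X ⊗ T.obj Y) ≫ δ T' (T.obj X) (T.obj Y) ≫
          (θ.inv.app (T.obj X) ⊗ₘ θ.inv.app (T.obj Y))) ≫
            ((S.muOfIso θ).app X ⊗ₘ (S.muOfIso θ).app Y)
    have h' : T'.map (θ.hom.app X) ≫ S.mu.app X ≫ θ.inv.app X ⊗ₘ
          T'.map (θ.hom.app Y) ≫ S.mu.app Y ≫ θ.inv.app Y =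
        (T'.map (θ.hom.app X) ⊗ₘ T'.map (θ.hom.app Y)) ≫
          (S.mu.app X ≫ θ.inv.app X ⊗ₘ S.mu.app Y ≫ θ.inv.app Y) := by
      rw [tensorHom_comp_tensorHom]
    simp only [muOfIso_app, Category.assoc, Iso.inv_hom_id_app_assoc, reassoc_of% h,
      tensorHom_comp_tensorHom, Functor.map_comp, NatTrans.naturality_assoc]
    rw [h', δ_natural_assoc, ← T'.map_comp_assoc (_ ⊗ₘ _), tensorHom_comp_tensorHom]
    simp
  mu_phi := by
    have h := S.mu_phi
    let := S.comonoidal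
    change (S.muOfIso θ).app (𝟙_ C) ≫ θ.hom.app (𝟙_ C) ≫ η T' =
      T.map (θ.hom.app (𝟙_ C) ≫ η T') ≫ θ.hom.app (𝟙_ C) ≫ η T'
    simp [h]
  unit_xi X Y := by
    have h := S.unit_xi X Y
    let := S.comonoidal
    change (S.unit ≫ θ.inv).app (X ⊗ Y) ≫
        θ.hom.app (X ⊗ Y) ≫ δ T' X Y ≫ (θ.inv.app X ⊗ₘ θ.inv.app Y) = _
    simp [reassoc_of% h]
  unit_phi := by
    have h := S.unit_phi
    let := S.comonoidal
    change (S.unit ≫ θ.inv).app (𝟙_ C) ≫ θ.hom.app (𝟙_ C) ≫ η T' = _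
    simpa using h

lemma isBimonadIso_ofIso (S : BimonadStructure T') (θ : T ≅ T') :
    (S.ofIso θ).IsBimonadIso S θ where
  mu X := by simp [ofIso]
  unit X := by simp [ofIso]
  xi X Y := by
    let := S.comonoidal
    change (θ.hom.app (X ⊗ Y) ≫ δ T' X Y ≫ (θ.inv.app X ⊗ₘ θ.inv.app Y)) ≫
      (θ.hom.app X ⊗ₘ θ.hom.app Y) = θ.hom.app (X ⊗ Y) ≫ δ T' X Y
    simp
  phi := rfl

lemma IsBimonadIso.trans {S : BimonadStructure T} {S' : BimonadStructure T'}
    {S'' : BimonadStructure T''} {θ : T ≅ T'} {θ' : T' ≅ T''} (h : S.IsBimonadIso S' θ)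
    (h' : S'.IsBimonadIso S'' θ') : S.IsBimonadIso S'' (θ ≪≫ θ') where
  mu X := by
    simp only [Iso.trans_hom, NatTrans.comp_app, reassoc_of% (h.mu X), h'.mu X, Functor.map_comp,
      Category.assoc, NatTrans.naturality_assoc]
  unit X := by
    simp only [Iso.trans_hom, NatTrans.comp_app, reassoc_of% (h.unit X), h'.unit X]
  xi X Y := by
    simp only [Iso.trans_hom, NatTrans.comp_app, ← tensorHom_comp_tensorHom,
      reassoc_of% (h.xi X Y), h'.xi X Y, Category.assoc]
  phi := by
    simp only [Iso.trans_hom, NatTrans.comp_app, Category.assoc, h'.phi, h.phi]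

end BimonadStructure

variable {D : Type*} [Category* D] [MonoidalCategory D]

/-- The bimonad of an adjunction depends on the right adjoint only, up to isomorphism. -/
lemma CategoryTheory.Adjunction.isBimonadIso_leftAdjointUniq {L L' : C ⥤ D} {F : D ⥤ C}
    [F.Monoidal] (adj : L ⊣ F) (adj' : L' ⊣ F) :
    adj.bimonad.IsBimonadIso adj'.bimonad
      (Functor.isoWhiskerRight (adj.leftAdjointUniq adj') F) where
  mu X := by
    change F.map (adj.counit.app (L.obj X)) ≫ F.map ((adj.leftAdjointUniq adj').hom.app X) =
      F.map (L.map (F.map ((adj.leftAdjointUniq adj').hom.app X))) ≫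
        F.map ((adj.leftAdjointUniq adj').hom.app (F.obj (L'.obj X))) ≫
          F.map (adj'.counit.app (L'.obj X))
    simp only [← F.map_comp]
    simp
  unit X := adj.unit_leftAdjointUniq_hom_app adj' X
  xi X Y := by
    let := adj.leftAdjointOplaxMonoidal
    change (F.map (δ L X Y) ≫ δ F _ _) ≫ (F.map ((adj.leftAdjointUniq adj').hom.app X) ⊗ₘ
      F.map ((adj.leftAdjointUniq adj').hom.app Y)) =
        F.map ((adj.leftAdjointUniq adj').hom.app (X ⊗ Y)) ≫
          F.map ((adj'.homEquiv _ _).symm ((adj'.unit.app X ⊗ₘ adj'.unit.app Y) ≫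
            Functor.LaxMonoidal.μ F _ _)) ≫ δ F _ _
    rw [Category.assoc, δ_natural, ← F.map_comp_assoc, ← F.map_comp_assoc]
    congr 2
    change (adj.homEquiv _ _).symm ((adj.unit.app X ⊗ₘ adj.unit.app Y) ≫
            Functor.LaxMonoidal.μ F _ _) ≫ _ = _
    apply (adj.homEquiv _ _).injective
    rw [← adj.homEquiv_naturality_right_symm]
    simp [Adjunction.homEquiv_unit, Adjunction.homEquiv_counit, ← Functor.LaxMonoidal.μ_natural]
  phi := by
    change F.map ((adj.leftAdjointUniq adj').hom.app (𝟙_ C)) ≫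
      F.map ((adj'.homEquiv _ _).symm (Functor.LaxMonoidal.ε F)) ≫ η F =
        F.map ((adj.homEquiv _ _).symm (Functor.LaxMonoidal.ε F)) ≫ η F
    rw [← F.map_comp_assoc]
    congr 2
    apply (adj.homEquiv _ _).injective
    simp [Adjunction.homEquiv_unit, Adjunction.homEquiv_counit]

end Transport

/-! ### The antipode of a finite-dimensional Hopf algebra -/

namespace HopfAlgebra

variable {k : Type*} [Field k] {A : Type*} [Ring A] [HopfAlgebra k A]
  {W : Type*} [AddCommGroup W] [Module k W]

/-- If `F(x ⊗ y₍₁₎ ⊗ y₍₂₎) = ε(y) B(x)`, then `F(a₍₁₎ ⊗ a₍₂₎ ⊗ a₍₃₎) = B(a)`. -/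
lemma apply_comul_rTensor_comul {M : Type*} [AddCommGroup M] [Module k M]
    (F : A ⊗[k] (A ⊗[k] A) →ₗ[k] M) (B : A →ₗ[k] M)
    (h : ∀ x y, F (x ⊗ₜ comul y) = (counit y : k) • B x) (a : A) :
    F (TensorProduct.assoc k A A A (comul.rTensor A (comul a))) = B a := by
  have h' : F ∘ₗ comul.lTensor A = B ∘ₗ (TensorProduct.rid k A).toLinearMap ∘ₗ
      (counit (R := k) (A := A)).lTensor A :=
    TensorProduct.ext' fun x y => by simp [h]
  rw [Coalgebra.coassoc_apply]
  have := LinearMap.congr_fun h' (comul a)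
  simpa using this

/-- If `F(x₍₁₎ ⊗ x₍₂₎ ⊗ y) = ε(x) B(y)`, then `F(a₍₁₎ ⊗ a₍₂₎ ⊗ a₍₃₎) = B(a)`. -/
lemma apply_comul_lTensor_comul {M : Type*} [AddCommGroup M] [Module k M]
    (F : A ⊗[k] (A ⊗[k] A) →ₗ[k] M) (B : A →ₗ[k] M)
    (h : ∀ x y, F (TensorProduct.assoc k A A A (comul x ⊗ₜ y)) = (counit x : k) • B y) (a : A) :
    F (comul.lTensor A (comul a)) = B a := by
  have h' : F ∘ₗ (TensorProduct.assoc k A A A).toLinearMap ∘ₗ comul.rTensor A =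
      B ∘ₗ (TensorProduct.lid k A).toLinearMap ∘ₗ (counit (R := k) (A := A)).rTensor A :=
    TensorProduct.ext' fun x y => by simp [h]
  rw [← Coalgebra.coassoc_apply]
  have := LinearMap.congr_fun h' (comul a)
  simpa using this

/-- The linear map `a ⊗ w ↦ a₍₁₎ ⊗ ρ(a₍₂₎) w`, for an arbitrary linear map `ρ`. -/
noncomputable def untwist (ρ : A →ₗ[k] Module.End k W) : A ⊗[k] W →ₗ[k] A ⊗[k] W :=
  (TensorProduct.lift ρ).lTensor A ∘ₗ (TensorProduct.assoc k A A W).toLinearMap ∘ₗ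
    comul.rTensor W

lemma untwist_tmul (ρ : A →ₗ[k] Module.End k W) {a : A} {ι : Type*} (r : Coalgebra.Repr k a ι)
    (w : W) : untwist ρ (a ⊗ₜ w) = ∑ j ∈ r.index, r.left j ⊗ₜ ρ (r.right j) w := by
  simp [untwist, ← r.eq, TensorProduct.sum_tmul]

/-- The inverse of `a ⊗ w ↦ a₍₁₎ ⊗ S(a₍₂₎) w` is `a ⊗ w ↦ a₍₁₎ ⊗ a₍₂₎ w`. -/
lemma injective_untwist_antipode (ρ : A →ₐ[k] Module.End k W) :
    Function.Injective (untwist (ρ.toLinearMap ∘ₗ antipode k)) := by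
  refine Function.LeftInverse.injective (g := untwist ρ.toLinearMap) fun t => ?_
  induction t with
  | zero => simp
  | add t t' h h' => simp only [map_add, h, h']
  | tmul b w =>
    let F : A ⊗[k] (A ⊗[k] A) →ₗ[k] A ⊗[k] W :=
      (LinearMap.applyₗ w ∘ₗ ρ.toLinearMap ∘ₗ LinearMap.mul' k A ∘ₗ
        (antipode k).lTensor A).lTensor A
    have h := apply_comul_rTensor_comul F ((TensorProduct.mk k A W).flip w) (fun x y => by
      simp [F, TensorProduct.tmul_smul, Algebra.algebraMap_eq_smul_one]) b
    have h' : ∀ t : A ⊗[k] A, untwist ρ.toLinearMap ((TensorProduct.lift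
        (ρ.toLinearMap ∘ₗ antipode k)).lTensor A (TensorProduct.assoc k A A W (t ⊗ₜ w))) =
          F (TensorProduct.assoc k A A A (comul.rTensor A t)) := by
      intro t
      induction t with
      | zero => simp
      | add t t' h h' => simp only [map_add, TensorProduct.add_tmul, h, h']
      | tmul x z =>
        have q := ℛ k x
        rw [TensorProduct.assoc_tmul, LinearMap.lTensor_tmul, TensorProduct.lift.tmul,
          untwist_tmul _ q, LinearMap.rTensor_tmul, ← q.eq]
        simp [F, TensorProduct.sum_tmul]
    exact (h' (comul b)).trans h

/-- The diagonal action of `a` on `A ⊗ W`. -/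
noncomputable def diagAct (ρ : A →ₗ[k] Module.End k W) : A →ₗ[k] Module.End k (A ⊗[k] W) :=
  TensorProduct.map₂ (LinearMap.mul k A) ρ ∘ₗ comul

/-- The map `a ⊗ w ↦ a₍₁₎ ⊗ S(a₍₂₎) w` carries the diagonal action to the action on the first
factor. -/
lemma untwist_antipode_diagAct (ρ : A →ₐ[k] Module.End k W) (a : A) (t : A ⊗[k] W) :
    untwist (ρ.toLinearMap ∘ₗ antipode k) (diagAct ρ.toLinearMap a t) =
      (LinearMap.mulLeft k a).rTensor W (untwist (ρ.toLinearMap ∘ₗ antipode k) t) := by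
  induction t with
  | zero => simp
  | add t t' h h' => simp only [map_add, h, h']
  | tmul b w =>
    let r := ℛ k b
    let F : A ⊗[k] (A ⊗[k] A) →ₗ[k] A ⊗[k] W := ∑ j ∈ r.index,
      TensorProduct.map (LinearMap.mulRight k (r.left j))
        (LinearMap.applyₗ w ∘ₗ ρ.toLinearMap ∘ₗ LinearMap.mulLeft k (antipode k (r.right j)) ∘ₗ
          LinearMap.mul' k A ∘ₗ (antipode k).rTensor A)
    let B : A →ₗ[k] A ⊗[k] W := ∑ j ∈ r.index,
      (TensorProduct.mk k A W).flip (ρ (antipode k (r.right j)) w) ∘ₗ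
        LinearMap.mulRight k (r.left j)
    have h := apply_comul_rTensor_comul F B (fun x y => by
      simp [F, B, Finset.smul_sum, TensorProduct.tmul_smul, Algebra.algebraMap_eq_smul_one]) a
    have h' : ∀ t : A ⊗[k] A, untwist (ρ.toLinearMap ∘ₗ antipode k)
        (TensorProduct.map₂ (LinearMap.mul k A) ρ.toLinearMap t (b ⊗ₜ w)) =
          F (TensorProduct.assoc k A A A (comul.rTensor A t)) := by
      intro t
      induction t with
      | zero => simp
      | add t t' h h' => simp only [map_add, LinearMap.add_apply, h, h']
      | tmul x z =>
        let q := ℛ k x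
        have h₁ : TensorProduct.map₂ (LinearMap.mul k A) ρ.toLinearMap (x ⊗ₜ z) (b ⊗ₜ w) =
          (x * b) ⊗ₜ ρ z w := by simp
        rw [h₁]
        simp only [untwist, LinearMap.comp_apply, LinearMap.rTensor_tmul, Bialgebra.comul_mul]
        simp [← q.eq, ← r.eq, Finset.sum_mul_sum, TensorProduct.sum_tmul, F,
          antipode_mul_antidistrib]
    rw [diagAct, LinearMap.comp_apply, h', h, untwist_tmul _ r]
    simp [B]

open Module

/-- A tensor is zero if all its contractions by functionals on the second factor are zero. -/
lemma _root_.TensorProduct.eq_zero_of_lTensor_dual {V : Type*} [AddCommGroup V] [Module k V]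
    (t : V ⊗[k] W) (h : ∀ g : Dual k W, TensorProduct.rid k V (g.lTensor V t) = 0) : t = 0 := by
  classical
  obtain ⟨b, rfl⟩ := TensorProduct.eq_repr_basis_right (Basis.ofVectorSpace k W) t
  generalize Basis.ofVectorSpace k W = c at h ⊢
  suffices b = 0 by simp [this]
  ext i
  have := h (c.coord i)
  simpa [Finsupp.sum, Finsupp.single_apply] using this

/-- A finite-dimensional Hopf algebra has a nonzero left integral. The identity map, as an element
of `A ⊗ A* ≅ End A`, is invariant under the diagonal action, and `A ⊗ A*` is isomorphic to a direct
sum of copies of the regular module `A`. -/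
lemma exists_ne_zero_mul_eq_counit_smul (k : Type*) [Field k] (A : Type*) [Ring A] [HopfAlgebra k A]
    [FiniteDimensional k A] : ∃ Λ : A, Λ ≠ 0 ∧ ∀ a, a * Λ = (counit a : k) • Λ := by
  have hone : (1 : A) ≠ 0 := fun h => by
    have := congrArg (counit (R := k)) h
    simp at this
  -- the left action `(a f)(x) = f(S(a) x)` on the dual space
  let ρ : A →ₐ[k] Module.End k (Dual k A) := AlgHom.ofLinearMap
    (Dual.transpose (R := k) (M := A) (M' := A) ∘ₗ LinearMap.mul k A ∘ₗ antipode k)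
    (by ext; simp [Dual.transpose_apply])
    (fun a b => by ext; simp [Dual.transpose_apply, antipode_mul_antidistrib, mul_assoc])
  let e : A ⊗[k] Dual k A ≃ₗ[k] (A →ₗ[k] A) :=
    TensorProduct.comm k A (Dual k A) ≪≫ₗ dualTensorHomEquiv k A A
  have he : ∀ x y v t, e (TensorProduct.map₂ (LinearMap.mul k A) ρ.toLinearMap (x ⊗ₜ y) t) v =
      x * e t (antipode k y * v) := by
    intro x y v t
    induction t with
    | zero => simp
    | add t t' h h' => simp only [map_add, LinearMap.add_apply, mul_add, h, h']
    | tmul b f => simp [e, ρ, Dual.transpose_apply]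
  let t := e.symm LinearMap.id
  have he' : ∀ s v, e (TensorProduct.map₂ (LinearMap.mul k A) ρ.toLinearMap s t) v =
      LinearMap.mul' k A ((antipode k).lTensor A s) * v := by
    intro s v
    induction s with
    | zero => simp
    | add s s' h h' => simp only [map_add, LinearMap.add_apply, add_mul, h, h']
    | tmul x y => rw [he]; simp [t, mul_assoc]
  have ht : ∀ a, diagAct ρ.toLinearMap a t = (counit a : k) • t := fun a => by
    apply e.injective
    ext v
    rw [diagAct, LinearMap.comp_apply, he']
    simp [t, Algebra.algebraMap_eq_smul_one]
  have ht₀ : untwist (ρ.toLinearMap ∘ₗ antipode k) t ≠ 0 := by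
    rw [Ne, map_eq_zero_iff _ (injective_untwist_antipode ρ)]
    intro h
    have := LinearMap.congr_fun (e.symm.map_eq_zero_iff.1 h) 1
    exact hone this
  obtain ⟨g, hg⟩ : ∃ g : Dual k (Dual k A), TensorProduct.rid k A (g.lTensor A
      (untwist (ρ.toLinearMap ∘ₗ antipode k) t)) ≠ 0 := by
    by_contra! h
    exact ht₀ (TensorProduct.eq_zero_of_lTensor_dual _ h)
  refine ⟨_, hg, fun a => ?_⟩
  have h : ∀ s : A ⊗[k] Dual k A, a * TensorProduct.rid k A (g.lTensor A s) =
      TensorProduct.rid k A (g.lTensor A ((LinearMap.mulLeft k a).rTensor (Dual k A) s)) := by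
    intro s
    induction s with
    | zero => simp
    | add s s' h h' => simp only [map_add, mul_add, h, h']
    | tmul x f => simp
  rw [h, ← untwist_antipode_diagAct, ht]
  simp

/-- For a left integral `Λ`, one has `S(a) Λ₍₁₎ ⊗ Λ₍₂₎ = Λ₍₁₎ ⊗ a Λ₍₂₎`. -/
lemma antipode_mul_comul_integral {Λ : A} (hΛ : ∀ a, a * Λ = (counit a : k) • Λ) (a : A) :
    (antipode k a ⊗ₜ[k] 1) * comul (R := k) Λ = (1 ⊗ₜ a) * comul Λ := by
  let F : A ⊗[k] (A ⊗[k] A) →ₗ[k] A ⊗[k] A :=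
    LinearMap.mulRight k (comul (R := k) Λ) ∘ₗ (LinearMap.mul' k A).rTensor A ∘ₗ
      (TensorProduct.assoc k A A A).symm.toLinearMap ∘ₗ (antipode k).rTensor (A ⊗[k] A)
  have h₁ := apply_comul_rTensor_comul F
    (LinearMap.mulRight k (comul (R := k) Λ) ∘ₗ (TensorProduct.mk k A A).flip 1 ∘ₗ antipode k)
    (fun x y => by
      have h : ∀ s : A ⊗[k] A, F (x ⊗ₜ s) = (antipode k x ⊗ₜ[k] 1) * (s * comul (R := k) Λ) := by
        intro s
        induction s with
        | zero => simp
        | add s s' h h' => simp only [map_add, TensorProduct.tmul_add, add_mul, mul_add, h, h']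
        | tmul y z => simp [F, ← mul_assoc]
      rw [h, ← Bialgebra.comul_mul, hΛ, map_smul, mul_smul_comm]
      rfl) a
  have h₂ : ∀ t : A ⊗[k] A, F (TensorProduct.assoc k A A A (comul.rTensor A t)) =
      (1 ⊗ₜ TensorProduct.lid k A ((counit (R := k) (A := A)).rTensor A t)) *
        comul (R := k) Λ := by
    intro t
    induction t with
    | zero => simp
    | add t t' h h' => simp only [map_add, TensorProduct.tmul_add, add_mul, h, h']
    | tmul x z =>
      have h : ∀ s : A ⊗[k] A, F (TensorProduct.assoc k A A A (s ⊗ₜ z)) =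
          (LinearMap.mul' k A ((antipode k).rTensor A s) ⊗ₜ z) * comul (R := k) Λ := by
        intro s
        induction s with
        | zero => simp
        | add s s' h h' => simp only [map_add, TensorProduct.add_tmul, add_mul, h, h']
        | tmul x y => simp [F]
      rw [LinearMap.rTensor_tmul, h]
      simp [Algebra.algebraMap_eq_smul_one, TensorProduct.smul_tmul]
  rw [h₂] at h₁
  simpa using h₁.symm

/-- The antipode of a finite-dimensional Hopf algebra is injective. If `S(h) = 0` and `Λ` is a
nonzero left integral, then `Λ₍₁₎ ⊗ h b Λ₍₂₎ = S(b) S(h) Λ₍₁₎ ⊗ Λ₍₂₎ = 0` for all `b`; taking for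
`b` the antipode of the middle term of the iterated coproduct of `Λ`, one gets
`Λ ⊗ h = Λ₍₁₎ ⊗ h S(Λ₍₂₎) Λ₍₃₎ = 0`. -/
lemma antipode_injective [FiniteDimensional k A] :
    Function.Injective (antipode k (A := A)) := by
  rw [injective_iff_map_eq_zero]
  intro h hh
  obtain ⟨Λ, hΛ₀, hΛ⟩ := exists_ne_zero_mul_eq_counit_smul k A
  obtain ⟨c, hc⟩ := TensorProduct.eq_repr_basis_left (Basis.ofVectorSpace k A) (comul (R := k) Λ)
  -- `b` must be allowed to depend on the first tensor factor, so the vanishing is needed for each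
  -- coefficient of a basis of that factor
  have h₁ : ∀ b i, h * (b * c i) = 0 := by
    intro b i
    have h₂ := antipode_mul_comul_integral hΛ (h * b)
    rw [antipode_mul_antidistrib, hh, mul_zero, TensorProduct.zero_tmul, zero_mul, ← hc] at h₂
    have h₃ := TensorProduct.sum_tmul_basis_left_eq_zero (Basis.ofVectorSpace k A)
      (c.mapRange (fun y => h * (b * y)) (by simp)) (by
        rw [Finsupp.sum_mapRange_index (by simp), h₂, Finsupp.mul_sum]
        simp [mul_assoc])
    simpa using DFunLike.congr_fun h₃ i
  let F : A ⊗[k] (A ⊗[k] A) →ₗ[k] A ⊗[k] A :=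
    (LinearMap.mulLeft k h ∘ₗ LinearMap.mul' k A ∘ₗ (antipode k).rTensor A).lTensor A
  have h₂ := apply_comul_rTensor_comul F ((TensorProduct.mk k A A).flip h) (fun x y => by
      simp [F, TensorProduct.tmul_smul, Algebra.algebraMap_eq_smul_one]) Λ
  have h₃ : ∀ i (s : A ⊗[k] A), F (TensorProduct.assoc k A A A (s ⊗ₜ c i)) = 0 := by
    intro i s
    induction s with
    | zero => simp
    | add s s' h h' => simp only [map_add, TensorProduct.add_tmul, h, h', add_zero]
    | tmul x y => simp [F, h₁]
  rw [← hc, Finsupp.sum, map_sum, map_sum, map_sum] at h₂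
  simp only [LinearMap.rTensor_tmul, h₃, Finset.sum_const_zero] at h₂
  have h₄ : Λ ⊗ₜ[k] h = 0 := h₂.symm
  obtain ⟨g, hg⟩ : ∃ g : Dual k A, g Λ ≠ 0 := by
    by_contra! hg
    exact hΛ₀ ((forall_dual_apply_eq_zero_iff k Λ).1 hg)
  simpa [hg] using congrArg (TensorProduct.lid k A ∘ g.rTensor A) h₄

/-- In a finite-dimensional Hopf algebra, the inverse `S'` of the antipode satisfies
`S'(a₍₂₎) a₍₁₎ = ε(a)`. -/
lemma exists_skew_antipode (k : Type*) [Field k] (A : Type*) [Ring A] [HopfAlgebra k A]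
    [FiniteDimensional k A] : ∃ S' : A →ₗ[k] A, ∀ a : A,
      LinearMap.mul' k A (TensorProduct.comm k A A (S'.lTensor A (comul a))) =
        algebraMap k A (counit a) := by
  let e := LinearEquiv.ofInjectiveEndo (antipode k (A := A)) antipode_injective
  refine ⟨e.symm, fun a => antipode_injective (k := k) ?_⟩
  have h : ∀ t : A ⊗[k] A, antipode k (LinearMap.mul' k A
      (TensorProduct.comm k A A ((e.symm : A →ₗ[k] A).lTensor A t))) =
        LinearMap.mul' k A ((antipode k).rTensor A t) := by
    intro t
    induction t with
    | zero => simp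
    | add t t' h h' => simp only [map_add, h, h']
    | tmul x y =>
      have : antipode k (e.symm y) = y := e.apply_symm_apply y
      simp [antipode_mul_antidistrib, this]
  rw [h]
  simp [Algebra.algebraMap_eq_smul_one]

end HopfAlgebra

/-! ### Induction along the inclusion into a bicrossed product -/

namespace CleftData

variable {k : Type u} [Field k] {K H Q : Type u} [Ring K] [Ring H] [Ring Q]

section Normalization

variable [Bialgebra k K] [Bialgebra k Q] (D : CleftData k K Q)

lemma cross_one_right (x : Q) : D.cross 1 x = 1 ⊗ₜ x := by
  have r := ℛ k x
  rw [D.cross_apply 1 r]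
  simp only [D.act_one, Algebra.algebraMap_eq_smul_one, TensorProduct.smul_tmul,
    ← TensorProduct.tmul_sum, Coalgebra.sum_counit_smul]

lemma cross_one_left (a : K) : D.cross a 1 = a ⊗ₜ 1 := by
  simp [cross, Algebra.TensorProduct.one_def, D.one_act]

lemma twistedMul_one_left (x : Q) : D.twistedMul 1 x = 1 ⊗ₜ x := by
  have r := ℛ k x
  simp only [twistedMul, TensorProduct.curry_apply, LinearMap.comp_apply, TensorProduct.map_tmul,
    Bialgebra.comul_one, Algebra.TensorProduct.one_def, ← r.eq, TensorProduct.tmul_sum, map_sum,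
    LinearEquiv.coe_coe, TensorProduct.tensorTensorTensorComm_tmul, TensorProduct.lift.tmul,
    LinearMap.mul'_apply, one_mul, D.σ_one_left, Algebra.algebraMap_eq_smul_one,
    TensorProduct.smul_tmul]
  rw [← TensorProduct.tmul_sum, Coalgebra.sum_counit_smul]

lemma twistedMul_one_right (x : Q) : D.twistedMul x 1 = 1 ⊗ₜ x := by
  have r := ℛ k x
  simp only [twistedMul, TensorProduct.curry_apply, LinearMap.comp_apply, TensorProduct.map_tmul,
    Bialgebra.comul_one, Algebra.TensorProduct.one_def, ← r.eq, TensorProduct.sum_tmul, map_sum,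
    LinearEquiv.coe_coe, TensorProduct.tensorTensorTensorComm_tmul, TensorProduct.lift.tmul,
    LinearMap.mul'_apply, mul_one, D.σ_one_right, Algebra.algebraMap_eq_smul_one,
    TensorProduct.smul_tmul]
  rw [← TensorProduct.tmul_sum, Coalgebra.sum_counit_smul]

lemma leftMul_one_tmul (t : K ⊗[k] Q) : leftMul k K Q (1 ⊗ₜ t) = t := by
  induction t with
  | zero => simp
  | add t t' h h' => simp only [TensorProduct.tmul_add, map_add, h, h']
  | tmul a x => simp

lemma actLeft_act_tmul (W : RightRep k K) (w : W) (a : K) (t : K ⊗[k] Q) :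
    actLeft Q W (W.act a w ⊗ₜ t) = actLeft Q W (w ⊗ₜ leftMul k K Q (a ⊗ₜ t)) := by
  induction t with
  | zero => simp
  | add t t' h h' => simp only [TensorProduct.tmul_add, map_add, h, h']
  | tmul b x => simp [W.act_mul]

end Normalization

section Induction

variable [HopfAlgebra k K] [HopfAlgebra k H] [HopfAlgebra k Q] (Φ : K ⊗[k] Q ≃ₗ[k] H)

/-- The section `x ↦ 1 # x` of the projection of a bicrossed product onto `Q`. -/
noncomputable def sect : Q →ₗ[k] H := Φ.toLinearMap ∘ₗ TensorProduct.mk k K Q 1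

lemma sect_apply (x : Q) : sect Φ x = Φ (1 ⊗ₜ x) := rfl

/-- The map `w ⊗ (a # x) ↦ w ↼ a ⊗ x`. It identifies `W ⊗ Q` with the induced module
`W ⊗_K H`, of which `w ⊗ h` is a representative on the left. -/
noncomputable def toInduced (W : RightRep k K) : W ⊗[k] H →ₗ[k] W ⊗[k] Q :=
  actLeft Q W ∘ₗ Φ.symm.toLinearMap.lTensor W

lemma toInduced_tmul (W : RightRep k K) (w : W) (t : K ⊗[k] Q) :
    toInduced Φ W (w ⊗ₜ Φ t) = actLeft Q W (w ⊗ₜ t) := by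
  simp [toInduced]

lemma toInduced_tmul_sect (W : RightRep k K) (w : W) (x : Q) :
    toInduced Φ W (w ⊗ₜ sect Φ x) = w ⊗ₜ x := by
  rw [sect_apply, toInduced_tmul, actLeft_tmul, W.act_one]
  rfl

/-- The action of `H` on the induced module, `(w ⊗ h) ↼ h' = w ⊗ h h'`, with `W ⊗ Q` in place of
`W ⊗_K H`. -/
noncomputable def indAct (W : RightRep k K) : H →ₗ[k] Module.End k (W ⊗[k] Q) where
  toFun h := toInduced Φ W ∘ₗ (LinearMap.mulRight k h ∘ₗ sect Φ).lTensor W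
  map_add' h h' := by
    refine TensorProduct.ext' fun w x => ?_
    simp [mul_add, TensorProduct.tmul_add]
  map_smul' c h := by
    refine TensorProduct.ext' fun w x => ?_
    simp

lemma indAct_tmul (W : RightRep k K) (h : H) (w : W) (x : Q) :
    indAct Φ W h (w ⊗ₜ x) = toInduced Φ W (w ⊗ₜ (sect Φ x * h)) := rfl

lemma toInduced_natural {W U : RightRep k K} (f : W ⟶ U) (t : W ⊗[k] H) :
    f.hom.rTensor Q (toInduced Φ W t) = toInduced Φ U (f.hom.rTensor H t) := by
  induction t with
  | zero => simp
  | add t t' h h' => simp only [map_add, h, h']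
  | tmul w h =>
    obtain ⟨t, rfl⟩ := Φ.surjective h
    rw [LinearMap.rTensor_tmul, toInduced_tmul, toInduced_tmul]
    induction t with
    | zero => simp
    | add t t' h h' => simp only [map_add, TensorProduct.tmul_add, h, h']
    | tmul a x =>
      have := LinearMap.congr_fun (f.comm a) w
      simp only [LinearMap.comp_apply] at this
      simp [this]

end Induction

namespace IsBicrossedProduct

variable [HopfAlgebra k K] [HopfAlgebra k H] [HopfAlgebra k Q] {D : CleftData k K Q}
  {i : K →ₐc[k] H} {π : H →ₐc[k] Q} {Φ : K ⊗[k] Q ≃ₗ[k] H}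

lemma inclusion_mul_tmul (hΦ : D.IsBicrossedProduct i π Φ) (a b : K) (x : Q) :
    i a * Φ (b ⊗ₜ x) = Φ ((a * b) ⊗ₜ x) := by
  rw [← hΦ.inclusion, hΦ.map_mul, cross_one_left]
  simp [twistedMul_one_left]

lemma inclusion_mul (hΦ : D.IsBicrossedProduct i π Φ) (a : K) (t : K ⊗[k] Q) :
    i a * Φ t = Φ (leftMul k K Q (a ⊗ₜ t)) := by
  induction t with
  | zero => simp
  | add t t' h h' => simp only [TensorProduct.tmul_add, mul_add, map_add, h, h']
  | tmul b x => rw [hΦ.inclusion_mul_tmul, leftMul_tmul]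

lemma inclusion_mul_sect (hΦ : D.IsBicrossedProduct i π Φ) (a : K) (x : Q) :
    i a * sect Φ x = Φ (a ⊗ₜ x) := by
  rw [sect_apply, hΦ.inclusion_mul_tmul, mul_one]

lemma sect_mul_inclusion (hΦ : D.IsBicrossedProduct i π Φ) (x : Q) (b : K) :
    sect Φ x * i b = Φ (D.cross b x) := by
  rw [← hΦ.inclusion, sect_apply, hΦ.map_mul]
  have h : D.twistedMul.flip 1 = TensorProduct.mk k K Q 1 :=
    LinearMap.ext fun y => D.twistedMul_one_right y
  rw [h, leftMul_one_tmul]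
  generalize D.cross b x = t
  congr 1
  induction t with
  | zero => simp
  | add t t' h h' => simp only [map_add, h, h']
  | tmul b x => simp

lemma sect_mul_sect (hΦ : D.IsBicrossedProduct i π Φ) (x y : Q) :
    sect Φ x * sect Φ y = Φ (D.twistedMul x y) := by
  rw [sect_apply, sect_apply, hΦ.map_mul, cross_one_right, LinearMap.lTensor_tmul,
    leftMul_one_tmul, leftMul_one_tmul]
  rfl

lemma comul_sect (hΦ : D.IsBicrossedProduct i π Φ) (x : Q) :
    comul (R := k) (sect Φ x) =
      TensorProduct.map Φ.toLinearMap Φ.toLinearMap (D.twistedComul x) := by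
  rw [sect_apply, hΦ.map_comul, Bialgebra.comul_one, Algebra.TensorProduct.one_def]
  generalize D.twistedComul x = t
  congr 1
  induction t with
  | zero => simp
  | add t t' h h' => simp only [TensorProduct.tmul_add, map_add, h, h']
  | tmul s t => simp [leftMul_one_tmul]

lemma counit_sect (hΦ : D.IsBicrossedProduct i π Φ) (x : Q) :
    (counit (sect Φ x) : k) = counit x := by
  simp [sect_apply, hΦ.map_counit]

lemma sect_one (hΦ : D.IsBicrossedProduct i π Φ) : sect Φ (1 : Q) = 1 := hΦ.map_one

/-- `ε(x . a) = ε(x) ε(a)`, by comparing counits in `(1 # x)(a # 1)`. -/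
lemma counit_act (hΦ : D.IsBicrossedProduct i π Φ) (x : Q) (a : K) :
    (counit (D.act x a) : k) = counit x * counit a := by
  have h := congrArg (counit (R := k)) (hΦ.sect_mul_inclusion x a)
  have h' : ∀ t : K ⊗[k] Q, (counit (Φ t) : k) =
      counit (R := k) (TensorProduct.rid k K ((counit (R := k) (A := Q)).lTensor K t)) := by
    intro t
    induction t with
    | zero => simp
    | add t t' h h' => simp only [map_add, h, h']
    | tmul b y => simp [hΦ.map_counit, mul_comm]
  have r := ℛ k x
  rw [Bialgebra.counit_mul, hΦ.counit_sect, h', D.cross_apply a r] at h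
  have h₁ : counit (R := k) (i a) = counit (R := k) a := by simp
  have h₂ := congrArg (TensorProduct.rid k Q) (Coalgebra.sum_tmul_counit_eq r)
  simp only [map_sum, TensorProduct.rid_tmul, one_smul] at h₂
  rw [h₁] at h
  rw [h]
  conv_lhs => rw [← h₂]
  simp

/-- The relation `w ↼ a ⊗ h = w ⊗ i(a) h` of the tensor product over `K`. -/
lemma toInduced_act_tmul (hΦ : D.IsBicrossedProduct i π Φ) (W : RightRep k K) (w : W) (a : K)
    (h : H) : toInduced Φ W (W.act a w ⊗ₜ h) = toInduced Φ W (w ⊗ₜ (i a * h)) := by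
  obtain ⟨t, rfl⟩ := Φ.surjective h
  rw [hΦ.inclusion_mul, toInduced_tmul, toInduced_tmul, actLeft_act_tmul]

lemma indAct_toInduced (hΦ : D.IsBicrossedProduct i π Φ) (W : RightRep k K) (w : W) (h h' : H) :
    indAct Φ W h' (toInduced Φ W (w ⊗ₜ h)) = toInduced Φ W (w ⊗ₜ (h * h')) := by
  obtain ⟨t, rfl⟩ := Φ.surjective h
  rw [toInduced_tmul]
  induction t with
  | zero => simp
  | add t t' h h' => simp only [map_add, TensorProduct.tmul_add, add_mul, h, h']
  | tmul a x =>
    rw [actLeft_tmul, indAct_tmul, hΦ.toInduced_act_tmul, ← mul_assoc, hΦ.inclusion_mul_sect]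

lemma tAct_eq_indAct (hΦ : D.IsBicrossedProduct i π Φ) (W : RightRep k K) (a : K) :
    D.tAct W a = indAct Φ W (i a) :=
  TensorProduct.ext' fun w x => by
    change actLeft Q W (w ⊗ₜ D.cross a x) = _
    rw [indAct_tmul, hΦ.sect_mul_inclusion, toInduced_tmul]

lemma indAct_mul (hΦ : D.IsBicrossedProduct i π Φ) (W : RightRep k K) (h h' : H) :
    indAct Φ W (h * h') = indAct Φ W h' ∘ₗ indAct Φ W h :=
  TensorProduct.ext' fun w x => by
    rw [LinearMap.comp_apply, indAct_tmul, indAct_tmul, hΦ.indAct_toInduced, mul_assoc]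

lemma indAct_one (Φ : K ⊗[k] Q ≃ₗ[k] H) (W : RightRep k K) :
    indAct Φ W 1 = LinearMap.id :=
  TensorProduct.ext' fun w x => by
    rw [indAct_tmul, mul_one, toInduced_tmul_sect]
    rfl

/-- The map `v ⊗ x ↦ v ↼ (1 # x)`, which is the action `v ⊗ h ↦ v ↼ h` on the module induced from
the restriction of `V`. -/
noncomputable def evalMap (i : K →ₐc[k] H) (Φ : K ⊗[k] Q ≃ₗ[k] H) (V : RightRep k H) :
    (RightRep.res i).obj V ⊗[k] Q →ₗ[k] V :=
  TensorProduct.lift (V.act.flip.compl₂ (sect Φ))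

lemma evalMap_tmul (V : RightRep k H) (v : (RightRep.res i).obj V) (x : Q) :
    evalMap i Φ V (v ⊗ₜ x) = V.act (sect Φ x) v := rfl

lemma evalMap_toInduced (hΦ : D.IsBicrossedProduct i π Φ) (V : RightRep k H)
    (v : (RightRep.res i).obj V) (h : H) :
    evalMap i Φ V (toInduced Φ ((RightRep.res i).obj V) (v ⊗ₜ h)) = V.act h v := by
  obtain ⟨t, rfl⟩ := Φ.surjective h
  rw [toInduced_tmul]
  induction t with
  | zero =>
    simp only [map_zero, TensorProduct.tmul_zero]
    rfl
  | add t t' h h' =>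
    simp only [map_add, TensorProduct.tmul_add, h, h']
    rfl
  | tmul a x =>
    rw [actLeft_tmul, evalMap_tmul, ← hΦ.inclusion_mul_sect, V.act_mul]
    rfl

variable [FiniteDimensional k Q]

/-- The induced module `W ⊗_K H`, on the vector space `W ⊗ Q`. -/
noncomputable abbrev indObj (hΦ : D.IsBicrossedProduct i π Φ) (W : RightRep k K) :
    RightRep k H where
  carrier := W ⊗[k] Q
  act := indAct Φ W
  act_one := indAct_one Φ W
  act_mul h h' := hΦ.indAct_mul W h h'

/-- The induction functor from right `K`-modules to right `H`-modules. -/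
noncomputable def ind (hΦ : D.IsBicrossedProduct i π Φ) : RightRep k K ⥤ RightRep k H where
  obj W := hΦ.indObj W
  map {W U} f := ⟨f.hom.rTensor Q, fun h => TensorProduct.ext' fun w x => by
    change f.hom.rTensor Q (indAct Φ W h (w ⊗ₜ x)) = indAct Φ U h (f.hom w ⊗ₜ x)
    rw [indAct_tmul, toInduced_natural, indAct_tmul, LinearMap.rTensor_tmul]⟩
  map_id W := by ext : 1; exact LinearMap.rTensor_id Q W
  map_comp f g := by ext : 1; exact LinearMap.rTensor_comp Q g.hom f.hom

/-- Induction is left adjoint to restriction. -/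
noncomputable def indAdj (hΦ : D.IsBicrossedProduct i π Φ) : hΦ.ind ⊣ RightRep.res i where
  unit :=
    { app W := ⟨etaMap W, fun a => LinearMap.ext fun w => by
        change W.act a w ⊗ₜ 1 = indAct Φ W (i a) (w ⊗ₜ 1)
        rw [indAct_tmul, hΦ.sect_one, one_mul, ← mul_one (i a), ← hΦ.toInduced_act_tmul,
          ← hΦ.sect_one, toInduced_tmul_sect]⟩
      naturality _ _ _ := rfl }
  counit :=
    { app V := ⟨evalMap i Φ V, fun h => TensorProduct.ext' fun v x => by
        change evalMap i Φ V (indAct Φ ((RightRep.res i).obj V) h (v ⊗ₜ x)) =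
          V.act h (V.act (sect Φ x) v)
        rw [indAct_tmul]
        refine (hΦ.evalMap_toInduced V v _).trans ?_
        rw [V.act_mul]
        rfl⟩
      naturality V V' f := by
        ext : 1
        exact TensorProduct.ext' fun v x => (LinearMap.congr_fun (f.comm (sect Φ x)) v).symm }
  left_triangle_components W := by
    ext : 1
    refine TensorProduct.ext' fun w x => ?_
    change indAct Φ W (sect Φ x) (w ⊗ₜ 1) = w ⊗ₜ x
    rw [indAct_tmul, hΦ.sect_one, one_mul, toInduced_tmul_sect]
  right_triangle_components V := by
    ext : 1
    refine LinearMap.ext fun v => ?_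
    change V.act (sect Φ (1 : Q)) v = v
    rw [hΦ.sect_one, V.act_one]
    rfl

/-- The functor `T` is the composite of induction and restriction; the isomorphism is the identity
on underlying vector spaces. -/
noncomputable def isoInd (hΦ : D.IsBicrossedProduct i π Φ) : D.T ≅ hΦ.ind ⋙ RightRep.res i :=
  NatIso.ofComponents (fun W => RightRep.mkIso (LinearEquiv.refl k (W ⊗[k] Q)) fun a =>
    hΦ.tAct_eq_indAct W a) fun _ => rfl

end IsBicrossedProduct
end CleftData

/-! ### Coinduction and trivial modules -/

namespace RightRep

variable {k : Type u} [Field k] {A B : Type u} [Ring A] [Ring B] [Bialgebra k A] [Bialgebra k B]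

/-- The space `Hom_A(B, W)` of maps `f : B → W` with `f(b i(a)) = f(b) ↼ a`. -/
def coindSubmodule (i : A →ₐc[k] B) (W : RightRep k A) : Submodule k (B →ₗ[k] W) where
  carrier := {f | ∀ b a, f (b * i a) = W.act a (f b)}
  add_mem' hf hg b a := by simp [hf b a, hg b a]
  zero_mem' b a := by simp
  smul_mem' c f hf b a := by simp [hf b a]

/-- The coinduced module `Hom_A(B, W)`, with `(f ↼ b)(b') = f(b b')`. -/
abbrev coindObj [FiniteDimensional k B] (i : A →ₐc[k] B) (W : RightRep k A) : RightRep k B where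
  carrier := coindSubmodule i W
  act :=
    { toFun b :=
        { toFun f := ⟨f.1 ∘ₗ LinearMap.mulLeft k b, fun b' a => by
            simp [← mul_assoc, f.2 (b * b') a]⟩
          map_add' f g := rfl
          map_smul' c f := rfl }
      map_add' b b' := by
        ext f b''
        simp [add_mul]
      map_smul' c b := by
        ext f b'
        simp }
  act_one := by ext f b; simp
  act_mul b b' := by ext f b''; simp

/-- Coinduction along a homomorphism of bialgebras. -/
def coind [FiniteDimensional k B] (i : A →ₐc[k] B) : RightRep k A ⥤ RightRep k B where
  obj W := coindObj i W
  map {W U} f :=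
    { hom :=
        { toFun g := ⟨f.hom ∘ₗ g.1, fun b a => by
            have := LinearMap.congr_fun (f.comm a) (g.1 b)
            simpa [g.2 b a] using this⟩
          map_add' g h := by ext; simp
          map_smul' c g := by ext; simp }
      comm b := rfl }

/-- Restriction is left adjoint to coinduction. -/
def resCoindAdj [FiniteDimensional k B] (i : A →ₐc[k] B) : res i ⊣ coind i where
  unit :=
    { app V :=
        { hom :=
            { toFun v := ⟨V.act.flip v, fun b a => LinearMap.congr_fun (V.act_mul b (i a)) v⟩
              map_add' v w := Subtype.ext (map_add V.act.flip v w)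
              map_smul' c v := Subtype.ext (map_smul V.act.flip c v) }
          comm b := LinearMap.ext fun v => Subtype.ext <| LinearMap.ext fun b' =>
            (LinearMap.congr_fun (V.act_mul b b') v).symm }
      naturality V V' f := by
        ext : 1
        exact LinearMap.ext fun v => Subtype.ext <| LinearMap.ext fun b =>
          (LinearMap.congr_fun (f.comm b) v).symm }
  counit :=
    { app W :=
        { hom := LinearMap.applyₗ (1 : B) ∘ₗ (coindSubmodule i W).subtype
          comm a := LinearMap.ext fun f => by
            change f.1 (i a * 1) = W.act a (f.1 1)
            rw [← f.2, mul_one, one_mul] }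
      naturality _ _ _ := rfl }
  left_triangle_components V := by
    ext : 1
    exact V.act_one
  right_triangle_components W := by
    ext : 1
    refine LinearMap.ext fun f => Subtype.ext <| LinearMap.ext fun b => ?_
    change f.1 (b * 1) = f.1 b
    rw [mul_one]

@[simp]
lemma zero_hom (V W : RightRep k A) : Hom.hom (0 : V ⟶ W) = 0 := rfl

lemma sum_hom {V W : RightRep k A} {ι : Type*} (s : Finset ι) (f : ι → (V ⟶ W)) :
    Hom.hom (∑ j ∈ s, f j : V ⟶ W) = ∑ j ∈ s, Hom.hom (f j) := by
  classical
  induction s using Finset.induction_on with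
  | empty => simp
  | insert j s hj h => simp [Finset.sum_insert hj, h]

/-- An equivariant bijective map is an isomorphism. -/
lemma isIso_of_bijective {V W : RightRep k A} (f : V ⟶ W) (hf : Function.Bijective f.hom) :
    IsIso f := by
  have : f = (mkIso (LinearEquiv.ofBijective f.hom hf) f.comm).hom := rfl
  rw [this]
  infer_instance

/-- A module on which `A` acts through the counit is a direct sum of copies of the unit object. -/
lemma isTrivialObject_of_act_eq (V : RightRep k A)
    (h : ∀ a, V.act a = (counit a : k) • LinearMap.id) : IsTrivialObject V := by
  let b := Module.finBasis k V
  let c : Limits.Bicone (fun _ : Fin (Module.finrank k V) => 𝟙_ (RightRep k A)) :=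
    { pt := V
      π j := ⟨b.coord j, fun a => by
        ext v
        simp [h]
        rfl⟩
      ι j := ⟨LinearMap.toSpanSingleton k V (b j), fun a => by
        refine LinearMap.ext_ring ?_
        change ((counit a : k) • (1 : k)) • b j = V.act a ((1 : k) • b j)
        simp [h]⟩
      ι_π j j' := by
        ext : 1
        refine LinearMap.ext_ring ?_
        change b.coord j' ((1 : k) • b j) = _
        split_ifs with hj
        · subst hj
          simp
        · simp [hj] }
  refine ⟨_, c, ⟨Limits.isBilimitOfTotal c ?_⟩, ⟨Iso.refl _⟩⟩
  ext : 1
  rw [sum_hom]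
  refine LinearMap.ext fun v => ?_
  rw [LinearMap.sum_apply]
  exact b.sum_repr v

end RightRep

/-! ### The Hopf monad structure on `T` -/

namespace CleftData

variable {k : Type u} [Field k] {K H Q : Type u} [Ring K] [Ring H] [Ring Q]
section
variable [Bialgebra k K] [Bialgebra k Q] (D : CleftData k K Q) [FiniteDimensional k Q]

lemma additive_T : D.T.Additive where
  map_add {W U f g} := by
    ext : 1
    exact LinearMap.rTensor_add _ _ _

lemma linear_T : Functor.Linear k D.T where
  map_smul {W U} f c := by
    ext : 1
    exact LinearMap.rTensor_smul _ _ _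

lemma faithful_T : D.T.Faithful where
  map_injective {W U f g} h := by
    ext w
    have h₁ : f.hom w ⊗ₜ[k] (1 : Q) = g.hom w ⊗ₜ[k] (1 : Q) :=
      LinearMap.congr_fun (congrArg RightRep.Hom.hom h) (w ⊗ₜ (1 : Q))
    have h₂ := congrArg (TensorProduct.rid k U ∘ (counit (R := k) (A := Q)).lTensor U) h₁
    simpa using h₂

end

namespace IsBicrossedProduct

variable [HopfAlgebra k K] [HopfAlgebra k H] [HopfAlgebra k Q] {D : CleftData k K Q}
  {i : K →ₐc[k] H} {π : H →ₐc[k] Q} {Φ : K ⊗[k] Q ≃ₗ[k] H}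

/-- The action of `s₁ ⊗ s₂` on `(w ⊗ h) ⊗ (u ⊗ h')` gives `(w ⊗ h s₁) ⊗ (u ⊗ h' s₂)`. -/
lemma pairAct_indAct_toInduced (hΦ : D.IsBicrossedProduct i π Φ) (W U : RightRep k K) (w : W)
    (u : U) (h h' : H) (s : H ⊗[k] H) :
    RightRep.pairAct (indAct Φ W) (indAct Φ U) s
        (toInduced Φ W (w ⊗ₜ h) ⊗ₜ toInduced Φ U (u ⊗ₜ h')) =
      TensorProduct.map (toInduced Φ W) (toInduced Φ U)
        (TensorProduct.tensorTensorTensorComm k W U H H ((w ⊗ₜ u) ⊗ₜ ((h ⊗ₜ h') * s))) := by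
  induction s with
  | zero => simp
  | add s s' h h' =>
    simp only [map_add, mul_add, TensorProduct.tmul_add, LinearMap.add_apply, h, h']
  | tmul a b => simp [hΦ.indAct_toInduced]

/-- The multiplication of `T` is the action of the elements `1 # x` on an induced module. -/
lemma muMap_tmul_eq (hΦ : D.IsBicrossedProduct i π Φ) (W : RightRep k K) (v : W ⊗[k] Q) (x : Q) :
    D.muMap W (v ⊗ₜ x) = indAct Φ W (sect Φ x) v := by
  induction v with
  | zero => simp
  | add v v' h h' => simp only [TensorProduct.add_tmul, map_add, h, h']
  | tmul w y =>
    rw [indAct_tmul, hΦ.sect_mul_sect, toInduced_tmul]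
    rfl

lemma muMap_toInduced (hΦ : D.IsBicrossedProduct i π Φ) [FiniteDimensional k Q]
    (W : RightRep k K) (v : W ⊗[k] Q) (h : H) :
    D.muMap W (toInduced Φ (D.tObj W) (v ⊗ₜ h)) = indAct Φ W h v := by
  obtain ⟨t, rfl⟩ := Φ.surjective h
  rw [toInduced_tmul]
  induction t with
  | zero => simp
  | add t t' h h' => simp only [map_add, TensorProduct.tmul_add, LinearMap.add_apply, h, h']
  | tmul a x =>
    rw [actLeft_tmul, ← hΦ.inclusion_mul_sect, hΦ.indAct_mul, hΦ.muMap_tmul_eq,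
      hΦ.tAct_eq_indAct]
    rfl

lemma xiMap_tmul_eq (hΦ : D.IsBicrossedProduct i π Φ) (W U : RightRep k K) (t : W ⊗[k] U)
    (x : Q) : D.xiMap W U (t ⊗ₜ x) =
      TensorProduct.map (toInduced Φ W) (toInduced Φ U)
        (TensorProduct.tensorTensorTensorComm k W U H H (t ⊗ₜ comul (sect Φ x))) := by
  have h : ∀ (t : W ⊗[k] U) (s : (K ⊗[k] Q) ⊗[k] (K ⊗[k] Q)),
    TensorProduct.map (actLeft Q W) (actLeft Q U)
      (TensorProduct.tensorTensorTensorComm k W U (K ⊗[k] Q) (K ⊗[k] Q) (t ⊗ₜ s)) =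
    TensorProduct.map (toInduced Φ W) (toInduced Φ U)
      (TensorProduct.tensorTensorTensorComm k W U H H (t ⊗ₜ
        TensorProduct.map Φ.toLinearMap Φ.toLinearMap s)) := by
    intro t s
    induction t with
    | zero => simp
    | add t t' h h' => simp only [map_add, TensorProduct.add_tmul, h, h']
    | tmul w u =>
      induction s with
      | zero => simp
      | add s s' h h' => simp only [map_add, TensorProduct.tmul_add, h, h']
      | tmul s s' => simp [toInduced_tmul]
  rw [hΦ.comul_sect, ← h]
  rfl

/-- In terms of representatives in `(W ⊗ U) ⊗ H`, the comonoidal structure is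
`(w ⊗ u) ⊗ h ↦ (w ⊗ h₍₁₎) ⊗ (u ⊗ h₍₂₎)`. -/
lemma xiMap_toInduced (hΦ : D.IsBicrossedProduct i π Φ) (W U : RightRep k K) (w : W)
    (u : U) (h : H) :
    D.xiMap W U (toInduced Φ (W ⊗ U) ((w ⊗ₜ u) ⊗ₜ h)) =
      TensorProduct.map (toInduced Φ W) (toInduced Φ U)
        (TensorProduct.tensorTensorTensorComm k W U H H ((w ⊗ₜ u) ⊗ₜ comul h)) := by
  -- the target is balanced over `K ⊗ K`, which accounts for the factor `a` of `h = a # x`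
  have hs : ∀ (s : K ⊗[k] K) (z : H ⊗[k] H),
      TensorProduct.map (toInduced Φ W) (toInduced Φ U)
        (TensorProduct.tensorTensorTensorComm k W U H H
          (RightRep.pairAct W.act U.act s (w ⊗ₜ u) ⊗ₜ z)) =
      TensorProduct.map (toInduced Φ W) (toInduced Φ U)
        (TensorProduct.tensorTensorTensorComm k W U H H ((w ⊗ₜ u) ⊗ₜ
          (TensorProduct.map (i : K →ₗ[k] H) (i : K →ₗ[k] H) s * z))) := by
    intro s z
    induction s with
    | zero => simp
    | add s s' h h' =>
      simp only [map_add, LinearMap.add_apply, add_mul, TensorProduct.add_tmul,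
        TensorProduct.tmul_add, h, h']
    | tmul a b =>
      induction z with
      | zero => simp
      | add z z' h h' => simp only [map_add, mul_add, TensorProduct.tmul_add, h, h']
      | tmul g g' => simp [hΦ.toInduced_act_tmul]
  obtain ⟨t, rfl⟩ := Φ.surjective h
  rw [toInduced_tmul]
  induction t with
  | zero => simp
  | add t t' h h' => simp only [map_add, TensorProduct.tmul_add, h, h']
  | tmul a x =>
    rw [actLeft_tmul, ← hΦ.inclusion_mul_sect, Bialgebra.comul_mul,
      ← CoalgHomClass.map_comp_comul_apply i a]
    exact (hΦ.xiMap_tmul_eq W U _ x).trans (hs (comul a) _)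

/-- `K` acts on `T(𝟙) = k ⊗ Q` through the counit. -/
lemma tAct_unit (hΦ : D.IsBicrossedProduct i π Φ) (a : K) :
    D.tAct (𝟙_ (RightRep k K)) a = (counit a : k) • LinearMap.id := by
  refine TensorProduct.ext' fun c x => ?_
  have r := ℛ k x
  rw [D.tAct_tmul _ a c r]
  have h : ∀ j, (RightRep.act (𝟙_ (RightRep k K)) (D.act (r.left j) a) c) ⊗ₜ[k] r.right j =
      (counit a : k) • (c ⊗ₜ[k] ((counit (r.left j) : k) • r.right j)) := by
    intro j
    change ((counit (D.act (r.left j) a) : k) • c) ⊗ₜ[k] r.right j = _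
    rw [hΦ.counit_act, mul_smul, TensorProduct.smul_tmul]
    rfl
  rw [Finset.sum_congr rfl fun j _ => h j, ← Finset.smul_sum, ← TensorProduct.tmul_sum,
    Coalgebra.sum_counit_smul]
  rfl

variable [FiniteDimensional k Q]

/-- Both induction and restriction are left adjoints, the latter because of coinduction. -/
lemma preservesFiniteColimits_T (hΦ : D.IsBicrossedProduct i π Φ) [FiniteDimensional k H] :
    Limits.PreservesFiniteColimits D.T := by
  have := hΦ.indAdj.leftAdjoint_preservesColimits
  have := (RightRep.resCoindAdj i).leftAdjoint_preservesColimits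
  have : Limits.PreservesFiniteColimits (hΦ.ind ⋙ RightRep.res i) := inferInstance
  exact Limits.preservesFiniteColimits_of_natIso hΦ.isoInd.symm

lemma isTrivialObject_T_unit (hΦ : D.IsBicrossedProduct i π Φ) :
    IsTrivialObject (D.T.obj (𝟙_ (RightRep k K))) :=
  RightRep.isTrivialObject_of_act_eq _ hΦ.tAct_unit

/-- The Hopf monad structure on `T`, which is that of the adjunction between induction and
restriction. -/
noncomputable def bimonad (hΦ : D.IsBicrossedProduct i π Φ) : BimonadStructure D.T :=
  hΦ.indAdj.bimonad.ofIso hΦ.isoInd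

lemma bimonad_mu_app_hom (hΦ : D.IsBicrossedProduct i π Φ) (W : RightRep k K) :
    (hΦ.bimonad.mu.app W).hom = D.muMap W := by
  refine TensorProduct.ext_threefold fun w x y => ?_
  exact (hΦ.muMap_tmul_eq W (w ⊗ₜ x) y).symm

lemma bimonad_unit_app_hom (hΦ : D.IsBicrossedProduct i π Φ) (W : RightRep k K) :
    (hΦ.bimonad.unit.app W).hom = etaMap W := rfl

lemma bimonad_phi_hom (hΦ : D.IsBicrossedProduct i π Φ) :
    hΦ.bimonad.phi.hom = phiMap k Q := by
  refine TensorProduct.ext' fun c x => ?_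
  change (counit (sect Φ x) : k) • c = _
  simp [hΦ.counit_sect, phiMap]

lemma bimonad_xi_hom (hΦ : D.IsBicrossedProduct i π Φ) (W U : RightRep k K) :
    (hΦ.bimonad.xi W U).hom = D.xiMap W U := by
  refine TensorProduct.ext_threefold fun w u x => ?_
  have h₁ : ∀ W : RightRep k K, ∀ w : W, w ⊗ₜ (1 : Q) = toInduced Φ W (w ⊗ₜ (1 : H)) :=
    fun W w => by rw [← hΦ.sect_one, toInduced_tmul_sect]
  have h₂ := hΦ.pairAct_indAct_toInduced W U w u 1 1 (comul (sect Φ x))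
  rw [← h₁, ← h₁, ← Algebra.TensorProduct.one_def, one_mul] at h₂
  refine .trans ?_ (h₂.trans (hΦ.xiMap_tmul_eq W U (w ⊗ₜ u) x).symm)
  change TensorProduct.map LinearMap.id LinearMap.id (RightRep.pairAct (indAct Φ W) (indAct Φ U)
    (comul (sect Φ x)) ((w ⊗ₜ (1 : Q)) ⊗ₜ (u ⊗ₜ (1 : Q)))) = _
  rw [TensorProduct.map_id]
  rfl

/-- The left fusion operator is `(w ⊗ v) ⊗ h ↦ (w ⊗ h₍₁₎) ⊗ v ↼ h₍₂₎`. -/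
lemma lTensor_muMap_xiMap_toInduced (hΦ : D.IsBicrossedProduct i π Φ) (X Y : RightRep k K)
    (w : X) (v : Y ⊗[k] Q) (h : H) :
    (D.muMap Y).lTensor (X ⊗[k] Q)
        (D.xiMap X (D.tObj Y) (toInduced Φ (X ⊗ D.tObj Y) ((w ⊗ₜ v) ⊗ₜ h))) =
      TensorProduct.map (toInduced Φ X ∘ₗ TensorProduct.mk k X H w)
        ((indAct Φ Y).flip v) (comul h) := by
  rw [hΦ.xiMap_toInduced]
  generalize comul (R := k) h = t
  induction t with
  | zero => simp
  | add t t' h h' => simp only [map_add, TensorProduct.tmul_add, h, h']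
  | tmul a b => simp [hΦ.muMap_toInduced]

/-- The right fusion operator is `(v ⊗ w) ⊗ h ↦ v ↼ h₍₁₎ ⊗ (w ⊗ h₍₂₎)`. -/
lemma rTensor_muMap_xiMap_toInduced (hΦ : D.IsBicrossedProduct i π Φ) (X Y : RightRep k K)
    (v : X ⊗[k] Q) (w : Y) (h : H) :
    (D.muMap X).rTensor (Y ⊗[k] Q)
        (D.xiMap (D.tObj X) Y (toInduced Φ (D.tObj X ⊗ Y) ((v ⊗ₜ w) ⊗ₜ h))) =
      TensorProduct.map ((indAct Φ X).flip v)
        (toInduced Φ Y ∘ₗ TensorProduct.mk k Y H w) (comul h) := by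
  rw [hΦ.xiMap_toInduced]
  generalize comul (R := k) h = t
  induction t with
  | zero => simp
  | add t t' h h' => simp only [map_add, TensorProduct.tmul_add, h, h']
  | tmul a b => simp [hΦ.muMap_toInduced]

/-- The left fusion operator is surjective: `(w ⊗ h) ⊗ v` is the image of
`(w ⊗ v ↼ S⁻¹(h₍₂₎)) ⊗ h₍₁₎`. -/
lemma surjective_leftFusion (hΦ : D.IsBicrossedProduct i π Φ) [FiniteDimensional k H]
    (X Y : RightRep k K) :
    Function.Surjective ((D.muMap Y).lTensor (X ⊗[k] Q) ∘ₗ D.xiMap X (D.tObj Y)) := by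
  obtain ⟨S', hS'⟩ := HopfAlgebra.exists_skew_antipode k H
  rw [← LinearMap.range_eq_top, eq_top_iff]
  rintro t -
  induction t with
  | zero => exact zero_mem _
  | add t t' h h' => exact add_mem h h'
  | tmul p v =>
    induction p with
    | zero =>
      rw [TensorProduct.zero_tmul]
      exact zero_mem _
    | add p p' h h' =>
      rw [TensorProduct.add_tmul]
      exact add_mem h h'
    | tmul w x =>
      have r := ℛ k (sect Φ x)
      refine ⟨∑ j ∈ r.index, toInduced Φ (X ⊗ D.tObj Y)
        ((w ⊗ₜ indAct Φ Y (S' (r.right j)) v) ⊗ₜ r.left j), ?_⟩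
      let F : H ⊗[k] (H ⊗[k] H) →ₗ[k] (X ⊗[k] Q) ⊗[k] (Y ⊗[k] Q) :=
        TensorProduct.map (toInduced Φ X ∘ₗ TensorProduct.mk k X H w)
          ((indAct Φ Y).flip v ∘ₗ LinearMap.mul' k H ∘ₗ (TensorProduct.comm k H H).toLinearMap ∘ₗ
            S'.lTensor H)
      have hF := HopfAlgebra.apply_comul_rTensor_comul F
        ((TensorProduct.mk k (X ⊗[k] Q) (Y ⊗[k] Q)).flip v ∘ₗ toInduced Φ X ∘ₗ
          TensorProduct.mk k X H w)
        (fun a b => by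
          simp [F, hS', Algebra.algebraMap_eq_smul_one, indAct_one, TensorProduct.tmul_smul])
        (sect Φ x)
      have h : ∀ (t : H ⊗[k] H) (b : H),
          TensorProduct.map (toInduced Φ X ∘ₗ TensorProduct.mk k X H w)
          ((indAct Φ Y).flip (indAct Φ Y (S' b) v)) t =
            F (TensorProduct.assoc k H H H (t ⊗ₜ b)) := by
        intro t b
        induction t with
        | zero => simp
        | add t t' h h' => simp only [map_add, TensorProduct.add_tmul, h, h']
        | tmul a a' => simp [F, hΦ.indAct_mul]
      rw [← r.eq] at hF
      simp only [map_sum, LinearMap.rTensor_tmul] at hF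
      simp only [map_sum, LinearMap.comp_apply, hΦ.lTensor_muMap_xiMap_toInduced, h]
      rw [hF]
      change toInduced Φ X (w ⊗ₜ sect Φ x) ⊗ₜ v = _
      rw [toInduced_tmul_sect]

/-- The right fusion operator is surjective: `v ⊗ (w ⊗ h)` is the image of
`(v ↼ S(h₍₁₎) ⊗ w) ⊗ h₍₂₎`. -/
lemma surjective_rightFusion (hΦ : D.IsBicrossedProduct i π Φ) (X Y : RightRep k K) :
    Function.Surjective ((D.muMap X).rTensor (Y ⊗[k] Q) ∘ₗ D.xiMap (D.tObj X) Y) := by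
  rw [← LinearMap.range_eq_top, eq_top_iff]
  rintro t -
  induction t with
  | zero => exact zero_mem _
  | add t t' h h' => exact add_mem h h'
  | tmul v p =>
    induction p with
    | zero =>
      rw [TensorProduct.tmul_zero]
      exact zero_mem _
    | add p p' h h' =>
      rw [TensorProduct.tmul_add]
      exact add_mem h h'
    | tmul w x =>
      have r := ℛ k (sect Φ x)
      refine ⟨∑ j ∈ r.index, toInduced Φ (D.tObj X ⊗ Y)
        ((indAct Φ X (HopfAlgebra.antipode k (r.left j)) v ⊗ₜ w) ⊗ₜ r.right j), ?_⟩
      let F : H ⊗[k] (H ⊗[k] H) →ₗ[k] (X ⊗[k] Q) ⊗[k] (Y ⊗[k] Q) :=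
        TensorProduct.map ((indAct Φ X).flip v ∘ₗ LinearMap.mul' k H ∘ₗ
            (HopfAlgebra.antipode k).rTensor H)
          (toInduced Φ Y ∘ₗ TensorProduct.mk k Y H w) ∘ₗ
            (TensorProduct.assoc k H H H).symm.toLinearMap
      have hF := HopfAlgebra.apply_comul_lTensor_comul F
        (TensorProduct.mk k (X ⊗[k] Q) (Y ⊗[k] Q) v ∘ₗ toInduced Φ Y ∘ₗ
          TensorProduct.mk k Y H w)
        (fun a b => by
          simp [F, Algebra.algebraMap_eq_smul_one, indAct_one, TensorProduct.smul_tmul'])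
        (sect Φ x)
      have h : ∀ (t : H ⊗[k] H) (b : H), TensorProduct.map
          ((indAct Φ X).flip (indAct Φ X (HopfAlgebra.antipode k b) v))
            (toInduced Φ Y ∘ₗ TensorProduct.mk k Y H w) t = F (b ⊗ₜ t) := by
        intro t b
        induction t with
        | zero => simp
        | add t t' h h' => simp only [map_add, TensorProduct.tmul_add, h, h']
        | tmul a a' => simp [F, hΦ.indAct_mul]
      rw [← r.eq] at hF
      simp only [map_sum, LinearMap.lTensor_tmul] at hF
      simp only [map_sum, LinearMap.comp_apply, hΦ.rTensor_muMap_xiMap_toInduced, h]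
      rw [hF]
      change v ⊗ₜ toInduced Φ Y (w ⊗ₜ sect Φ x) = _
      rw [toInduced_tmul_sect]

/-- Source and target have the same dimension. -/
lemma bijective_leftFusion (hΦ : D.IsBicrossedProduct i π Φ) [FiniteDimensional k H]
    (X Y : RightRep k K) :
    Function.Bijective ((D.muMap Y).lTensor (X ⊗[k] Q) ∘ₗ D.xiMap X (D.tObj Y)) :=
  ⟨(LinearMap.injective_iff_surjective_of_finrank_eq_finrank
    (by simp only [Module.finrank_tensorProduct]; ring)).2 (hΦ.surjective_leftFusion X Y),
    hΦ.surjective_leftFusion X Y⟩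

/-- Source and target have the same dimension. -/
lemma bijective_rightFusion (hΦ : D.IsBicrossedProduct i π Φ)
    (X Y : RightRep k K) :
    Function.Bijective ((D.muMap X).rTensor (Y ⊗[k] Q) ∘ₗ D.xiMap (D.tObj X) Y) :=
  ⟨(LinearMap.injective_iff_surjective_of_finrank_eq_finrank
    (by simp only [Module.finrank_tensorProduct]; ring)).2 (hΦ.surjective_rightFusion X Y),
    hΦ.surjective_rightFusion X Y⟩

lemma isHopf_bimonad (hΦ : D.IsBicrossedProduct i π Φ) [FiniteDimensional k H] :
    hΦ.bimonad.IsHopf := by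
  intro X Y
  constructor
  · apply RightRep.isIso_of_bijective
    have h : (hΦ.bimonad.leftFusion X Y).hom =
        (D.muMap Y).lTensor (X ⊗[k] Q) ∘ₗ D.xiMap X (D.tObj Y) := by
      rw [← hΦ.bimonad_mu_app_hom, ← hΦ.bimonad_xi_hom]
      rfl
    rw [h]
    exact hΦ.bijective_leftFusion X Y
  · apply RightRep.isIso_of_bijective
    have h : (hΦ.bimonad.rightFusion X Y).hom =
        (D.muMap X).rTensor (Y ⊗[k] Q) ∘ₗ D.xiMap (D.tObj X) Y := by
      rw [← hΦ.bimonad_mu_app_hom, ← hΦ.bimonad_xi_hom]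
      rfl
    rw [h]
    exact hΦ.bijective_rightFusion X Y

end IsBicrossedProduct
end CleftData

theorem mainTheorem8 {k : Type u} [Field k] {K H Q : Type u} [Ring K] [Ring H] [Ring Q]
    [HopfAlgebra k K] [HopfAlgebra k H] [HopfAlgebra k Q]
    [FiniteDimensional k K] [FiniteDimensional k H] [FiniteDimensional k Q]
    (i : K →ₐc[k] H) (π : H →ₐc[k] Q) (hex : IsHopfExact i π)
    (D : CleftData k K Q) (Φ : K ⊗[k] Q ≃ₗ[k] H) (hΦ : D.IsBicrossedProduct i π Φ) :
    ∃ S : BimonadStructure D.T,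
      -- the explicit formulas for the multiplication, the unit and the comonoidal structure
      (∀ W : RightRep k K, (S.mu.app W).hom = D.muMap W) ∧
      (∀ W : RightRep k K, (S.unit.app W).hom = CleftData.etaMap W) ∧
      (∀ W U : RightRep k K, (S.xi W U).hom = D.xiMap W U) ∧
      S.phi.hom = CleftData.phiMap k Q ∧
      -- this is a normal (`k`-linear, right exact, with `T 𝟙` trivial), faithful Hopf monad
      S.IsHopf ∧
      D.T.Additive ∧ Functor.Linear k D.T ∧ Limits.PreservesFiniteColimits D.T ∧
      IsTrivialObject (D.T.obj (𝟙_ (RightRep k K))) ∧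
      D.T.Faithful ∧
      -- it is the Hopf monad of the restriction functor `Rep H ⥤ Rep K` and its left adjoint
      (RightRep.res i).IsRightAdjoint ∧
      ∀ (L : RightRep k K ⥤ RightRep k H) (adj : L ⊣ RightRep.res i),
        ∃ θ : D.T ≅ L ⋙ RightRep.res i, S.IsBimonadIso adj.bimonad θ ∧
          ∀ (W : RightRep k K) (w : W) (a : K) (x : Q),
            (θ.hom.app W).hom (W.act a w ⊗ₜ[k] x) =
              (L.obj W).act (Φ (a ⊗ₜ[k] x)) ((adj.unit.app W).hom w) := by
  refine ⟨hΦ.bimonad, hΦ.bimonad_mu_app_hom, hΦ.bimonad_unit_app_hom, hΦ.bimonad_xi_hom,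
    hΦ.bimonad_phi_hom, hΦ.isHopf_bimonad, D.additive_T, D.linear_T, hΦ.preservesFiniteColimits_T,
    hΦ.isTrivialObject_T_unit, D.faithful_T, hΦ.indAdj.isRightAdjoint, fun L adj => ?_⟩
  refine ⟨hΦ.isoInd ≪≫ Functor.isoWhiskerRight (hΦ.indAdj.leftAdjointUniq adj) (RightRep.res i),
    (hΦ.indAdj.bimonad.isBimonadIso_ofIso hΦ.isoInd).trans
      (hΦ.indAdj.isBimonadIso_leftAdjointUniq adj), fun W w a x => ?_⟩
  -- `(w ↼ a) ⊗ x` is `(w ⊗ 1) ↼ (a # x)`, and the comparison map is `H`-linear and carries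
  -- the unit `w ↦ w ⊗ 1` of the explicit adjunction to that of the given one
  let f := (hΦ.indAdj.leftAdjointUniq adj).hom.app W
  have h₁ : W.act a w ⊗ₜ[k] x = CleftData.indAct Φ W (Φ (a ⊗ₜ x)) (w ⊗ₜ (1 : Q)) := by
    rw [CleftData.indAct_tmul, hΦ.sect_one, one_mul, CleftData.toInduced_tmul,
      CleftData.actLeft_tmul]
  have h₂ : f.hom (w ⊗ₜ (1 : Q)) = (adj.unit.app W).hom w :=
    LinearMap.congr_fun
      (congrArg RightRep.Hom.hom (hΦ.indAdj.unit_leftAdjointUniq_hom_app adj W)) w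
  change f.hom (W.act a w ⊗ₜ[k] x) = _
  rw [h₁, ← h₂]
  exact LinearMap.congr_fun (f.comm (Φ (a ⊗ₜ x))) (w ⊗ₜ (1 : Q))
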